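/- Let $M$ be a finite-dimensional smooth manifold (over $\mathbb R$) or complex manifold (over $\mathbb C$), write $\Bbbk$ for the ground field and $\mathcal O$ for the sheaf of smooth, respectively holomorphic, functions. Let $\mathcal A\to M$ be a Lie algebroid: a vector bundle of finite rank with a Lie bracket $\lfloor\cdot,\cdot\rfloor$ on its (local) sections and a bundle map $\delta:\mathcal A\to TM$ (the anchor) such that $[\delta_{\varepsilon_1},\delta_{\varepsilon_2}]=\delta_{\lfloor\varepsilon_1,\varepsilon_2\rfloor}$ and $\lfloor\varepsilon_1,f\varepsilon_2\rfloor=f\lfloor\varepsilon_1,\varepsilon_2\rfloor+(\delta_{\varepsilon_1}f)\varepsilon_2$. Let $\{U_\alpha\}$ be an open cover of $M$, $U_{\alpha\beta}=U_\alpha\cap U_\beta$. **Definitions.** A one-cocycle of $\mathcal A$ is a pair $(c_\alpha(x;\varepsilon),c_{\alpha\beta}(x))$ with $c_\alpha\in\Gamma(U_\alpha,\mathcal A^*)$, $c_{\alpha\beta}\in\mathcal O(U_{\alpha\beta})$ and $$\delta_{\varepsilon_1}c_\alpha(\varepsilon_2)-\delta_{\varepsilon_2}c_\alpha(\varepsilon_1)-c_\alpha(\lfloor\varepsilon_1,\varepsilon_2\rfloor)=0,\quad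 \delta_\varepsilon c_{\alpha\beta}=-c_\alpha(\varepsilon)+c_\beta(\varepsilon),\quad c_{\alpha\gamma}=c_{\alpha\beta}+c_{\beta\gamma};$$ coboundaries are the pairs $(\delta_\varepsilon f_\alpha,\ f_\beta-f_\alpha)$ with $f_\alpha\in\mathcal O(U_\alpha)$; $H^1(\mathcal A,\mathcal O(M))$ is the quotient group (computed with the given cover). An affine space $\mathcal R$ over $T^*M$ is glued from the $T^*U_\alpha$ by $\xi_\alpha=\xi_\beta+\varsigma_{\alpha\beta}$ with closed one-forms $\varsigma_{\alpha\beta}$ on $U_{\alpha\beta}$, $\varsigma_{\alpha\beta}+\varsigma_{\beta\gamma}=\varsigma_{\alpha\gamma}$; its fibres are affine spaces over $T^*_xM$, and it carries the symplectic form $\omega=\langle d\xi_\alpha\wedge dx\rangle$ and the Poisson bracket with $\{h,x\}=\partial h/\partial\xi$, $\{h,\xi\}=-\partial h/\partial x$. A Hamiltonian lift of the anchor action to $\mathcal R$ is a smooth bundle map $\mathcal R\to\mathcal A^*$ over $M$, that is, an $\mathcal O$-linear assignment $\varepsilon\mapsto h_\varepsilon\in\mathcal O(\mathcal R)$, such that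 the Hamiltonian vector field $\{h_\varepsilon,\cdot\}$ projects to $\delta_\varepsilon$ and $\{h_{\varepsilon_1},h_{\varepsilon_2}\}=h_{\lfloor\varepsilon_1,\varepsilon_2\rfloor}$. **Statement.** 1. A bundle map $\mathcal R\to\mathcal A^*$ is a Hamiltonian lift if and only if in the coordinates over each $U_\alpha$ $$h_\varepsilon=\langle\delta_\varepsilon|\xi_\alpha\rangle+c_\alpha(x;\varepsilon),$$ where $c_\alpha\in\Gamma(U_\alpha,\mathcal A^*)$ satisfies the first cocycle equation and $c_\beta(\varepsilon)-c_\alpha(\varepsilon)=\langle\delta_\varepsilon|\varsigma_{\alpha\beta}\rangle$ on $U_{\alpha\beta}$. 2. For a Hamiltonian lift of this form and a section of $\mathcal R$ given by the one-forms $\xi_\alpha$, the covector $\rho_\varepsilon\xi=\mathcal L_{\delta_\varepsilon}\xi_\alpha+dc_\alpha(x;\varepsilon)$ does not depend on $\alpha$, and at the points of the section the Hamiltonian vector field of $h_\varepsilon$ is the derivative of the section along $\delta_\varepsilon$ minus the vertical vector $\rho_\varepsilon\xi$. 3. Every one-cocycle $(c_\alpha,c_{\alpha\beta})$ of $\mathcal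 A$ gives a Hamiltonian lift $h_\varepsilon=\langle\delta_\varepsilon|\xi_\alpha\rangle+c_\alpha(x;\varepsilon)$ of the anchor action to an affine space $\mathcal R$ over $T^*M$, namely the one with $\varsigma_{\alpha\beta}=dc_{\alpha\beta}$. In particular (zero cocycle) the anchor action lifts to $T^*M$. 4. Let $\mathcal R$, with transition forms $\varsigma_{\alpha\beta}$, have a Hamiltonian lift $h^0$ (for example $\mathcal R=T^*M$, $h^0_\varepsilon=\langle\delta_\varepsilon|\xi\rangle$). Consider the pairs consisting of a Čech cocycle $c_{\alpha\beta}\in\mathcal O(U_{\alpha\beta})$ and a Hamiltonian lift $h$ to the affine space with transition forms $\varsigma_{\alpha\beta}+dc_{\alpha\beta}$; call $(c_{\alpha\beta},h)$ and $(c'_{\alpha\beta},h')$ equivalent if there are $f_\alpha\in\mathcal O(U_\alpha)$ such that $c'_{\alpha\beta}=c_{\alpha\beta}+f_\beta-f_\alpha$ and the shift $\xi'_\alpha=\xi_\alpha-df_\alpha$ takes $h$ to $h'$. The equivalence classes are in one-to-one correspondence with $H^1(\mathcal A,\mathcal O(M))$: the class of $(c_\alpha,c_{\alpha\beta})$ corresponds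 to $h_\varepsilon=h^0_\varepsilon+c_\alpha(x;\varepsilon)$ in the coordinates over $U_\alpha$. 5. Let $\mathcal R$ have a Hamiltonian lift $h^0$. The Hamiltonian lifts to this fixed $\mathcal R$, up to shifts $\xi\mapsto\xi-df$ with $f\in\mathcal O(M)$, are in one-to-one correspondence with the group of global cocycles $c\in\Gamma(M,\mathcal A^*)$, $\delta_{\varepsilon_1}c(\varepsilon_2)-\delta_{\varepsilon_2}c(\varepsilon_1)=c(\lfloor\varepsilon_1,\varepsilon_2\rfloor)$, modulo the $\delta_\varepsilon f$, $f\in\mathcal O(M)$ (this is $H^1(\mathcal A,\mathcal O(M))$ computed with the cover $\{M\}$), by $h_\varepsilon=h^0_\varepsilon+c(x;\varepsilon)$. -/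

import Mathlib

open Bundle Set TopologicalSpace VectorField
open scoped Manifold ContDiff Topology

noncomputable section

namespace Algd

section Basic

variable (𝕜 : Type*) [RCLike 𝕜] (E : Type*) [NormedAddCommGroup E] [NormedSpace 𝕜 E]
  {M : Type*} [TopologicalSpace M] [ChartedSpace E M]

/-- The cotangent space `T*ₓM` of a manifold `M` modelled on `E`. Here and below `𝕜` is `ℝ`
(smooth manifolds) or `ℂ` (complex manifolds; `C^∞` over `ℂ` means holomorphic). -/
abbrev Cot (x : M) : Type _ := TangentSpace 𝓘(𝕜, E) x →L[𝕜] 𝕜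

/-- The differential `df` of a function, as a field of covectors. -/
def dfun (f : M → 𝕜) (x : M) : Cot 𝕜 E x := mfderiv 𝓘(𝕜, E) 𝓘(𝕜, 𝕜) f x

/-- The derivative of the function `f` at `x` along the tangent vector `v`. -/
def along (f : M → 𝕜) (x : M) (v : TangentSpace 𝓘(𝕜, E) x) : 𝕜 := dfun 𝕜 E f x v

/-- `f` is a regular function on `U`: an element of `𝒪(U)`. -/
def FunOn (f : M → 𝕜) (U : Set M) : Prop := ContMDiffOn 𝓘(𝕜, E) 𝓘(𝕜, 𝕜) ∞ f U

/-- `V` is a smooth vector field on `U`. -/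
def FieldOn [IsManifold 𝓘(𝕜, E) ∞ M] (V : Π x : M, TangentSpace 𝓘(𝕜, E) x) (U : Set M) : Prop :=
  ContMDiffOn 𝓘(𝕜, E) (𝓘(𝕜, E).prod 𝓘(𝕜, E)) ∞
    (fun x => TotalSpace.mk' E (E := fun x : M => TangentSpace 𝓘(𝕜, E) x) x (V x)) U

/-- `θ` is a smooth differential one-form on `U`. -/
def FormOn [IsManifold 𝓘(𝕜, E) ∞ M] (θ : Π x : M, Cot 𝕜 E x) (U : Set M) : Prop :=
  ContMDiffOn 𝓘(𝕜, E) (𝓘(𝕜, E).prod 𝓘(𝕜, E →L[𝕜] 𝕜)) ∞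
    (fun x => TotalSpace.mk' (E →L[𝕜] 𝕜) (E := fun x : M => Cot 𝕜 E x) x (θ x)) U

/-- `dθ = 0` on `U`, where `dθ(X, Y) = X(θ(Y)) - Y(θ(X)) - θ([X, Y])`. -/
def ClosedOn [IsManifold 𝓘(𝕜, E) ∞ M] (θ : Π x : M, Cot 𝕜 E x) (U : Set M) : Prop :=
  ∀ W : Set M, IsOpen W → W ⊆ U → ∀ X Y : Π x : M, TangentSpace 𝓘(𝕜, E) x,
    FieldOn 𝕜 E X W → FieldOn 𝕜 E Y W → ∀ x ∈ W,
      along 𝕜 E (fun y => θ y (Y y)) x (X x) - along 𝕜 E (fun y => θ y (X y)) x (Y x)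
        - θ x (mlieBracket 𝓘(𝕜, E) X Y x) = 0

/-! ### The symplectic geometry of the cotangent bundle -/

variable (M) in
/-- The total space of the cotangent bundle `T*M`. Its points are pairs `⟨x, ξ⟩`. -/
abbrev CotBundle : Type _ := TotalSpace (E →L[𝕜] 𝕜) (fun x : M => Cot 𝕜 E x)

variable [IsManifold 𝓘(𝕜, E) ∞ M]

/-- The model with corners of `T*M`. -/
abbrev cotModel : ModelWithCorners 𝕜 (E × (E →L[𝕜] 𝕜)) (ModelProd E (E →L[𝕜] 𝕜)) :=
  𝓘(𝕜, E).prod 𝓘(𝕜, E →L[𝕜] 𝕜)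

variable {E}

/-- The tangent space `T_z(T*M)`. Mathlib identifies it with `E × E*` by means of the preferred
chart of `T*M` at `z`, that is, by the canonical coordinates `(x, ξ)` which belong to the preferred
chart of `M` at the base point of `z`. -/
abbrev CotTangent (z : CotBundle 𝕜 E M) : Type _ := TangentSpace (cotModel 𝕜 E) z

/-- The components `(dx(X), dξ(X))` of a tangent vector in canonical coordinates. -/
def comps {z : CotBundle 𝕜 E M} (X : CotTangent 𝕜 z) : E × (E →L[𝕜] 𝕜) := X

/-- The tangent vector with components `(v, p)` in canonical coordinates. -/
def ofComps (z : CotBundle 𝕜 E M) (v : E) (p : E →L[𝕜] 𝕜) : CotTangent 𝕜 z :=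
  ((v, p) : E × (E →L[𝕜] 𝕜))

/-- The canonical symplectic form `ω = ⟨dξ ∧ dx⟩` of `T*M`. -/
def omega (z : CotBundle 𝕜 E M) (X Y : CotTangent 𝕜 z) : 𝕜 :=
  (comps 𝕜 X).2 (comps 𝕜 Y).1 - (comps 𝕜 Y).2 (comps 𝕜 X).1

/-- The derivative of a function on `T*M` along a tangent vector of `T*M`. -/
def dcot (h : CotBundle 𝕜 E M → 𝕜) (z : CotBundle 𝕜 E M) (X : CotTangent 𝕜 z) : 𝕜 :=
  (mfderiv (cotModel 𝕜 E) 𝓘(𝕜, 𝕜) h z : CotTangent 𝕜 z →L[𝕜] 𝕜) X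

/-- `X` is the value at `z` of the Hamiltonian vector field `{h, ·}` of `h`. The sign is the one for
which `{h, x} = ∂h/∂ξ` and `{h, ξ} = -∂h/∂x`. -/
def IsHamAt (h : CotBundle 𝕜 E M → 𝕜) (z : CotBundle 𝕜 E M) (X : CotTangent 𝕜 z) : Prop :=
  ∀ Y : CotTangent 𝕜 z, omega 𝕜 z Y X = dcot 𝕜 h z Y

/-- The partial differential `∂f/∂x` at `z` in canonical coordinates. -/
def dbase (f : CotBundle 𝕜 E M → 𝕜) (z : CotBundle 𝕜 E M) : E →L[𝕜] 𝕜 :=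
  (mfderiv (cotModel 𝕜 E) 𝓘(𝕜, 𝕜) f z : E × (E →L[𝕜] 𝕜) →L[𝕜] 𝕜).comp
    (ContinuousLinearMap.inl 𝕜 E (E →L[𝕜] 𝕜))

/-- The canonical Poisson bracket `{f, g} = ⟨∂f/∂ξ|∂g/∂x⟩ - ⟨∂f/∂x|∂g/∂ξ⟩` of `T*M`. -/
def poisson (f g : CotBundle 𝕜 E M → 𝕜) (z : CotBundle 𝕜 E M) : 𝕜 :=
  dcot 𝕜 f z (ofComps 𝕜 z 0 (dbase 𝕜 g z)) - dcot 𝕜 g z (ofComps 𝕜 z 0 (dbase 𝕜 f z))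

/-- `{f, g}` is the derivative of `g` along the Hamiltonian vector field of `f`. -/
theorem poisson_eq (f g : CotBundle 𝕜 E M → 𝕜) (z : CotBundle 𝕜 E M) (X : CotTangent 𝕜 z)
    (hX : IsHamAt 𝕜 f z X) : poisson 𝕜 f g z = dcot 𝕜 g z X := by
  have h1 := hX (ofComps 𝕜 z 0 (dbase 𝕜 g z))
  have h2 : dbase 𝕜 f z = -(comps 𝕜 X).2 := by
    ext v
    have := hX (ofComps 𝕜 z v 0)
    simp only [omega, comps, ofComps] at this
    have e : dbase 𝕜 f z v = dcot 𝕜 f z (ofComps 𝕜 z v 0) := rfl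
    rw [e]
    simp only [ofComps, comps]
    rw [← this]
    simp
  have h3 : dcot 𝕜 g z X = dbase 𝕜 g z (comps 𝕜 X).1 + dcot 𝕜 g z (ofComps 𝕜 z 0 (comps 𝕜 X).2) := by
    have e : (X : CotTangent 𝕜 z) = ofComps 𝕜 z (comps 𝕜 X).1 0 + ofComps 𝕜 z 0 (comps 𝕜 X).2 := by
      exact Prod.ext (add_zero _).symm (zero_add _).symm
    conv_lhs => rw [e]
    exact map_add (mfderiv (cotModel 𝕜 E) 𝓘(𝕜, 𝕜) g z : CotTangent 𝕜 z →L[𝕜] 𝕜) _ _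
  have h4 : dcot 𝕜 g z (ofComps 𝕜 z 0 (-(comps 𝕜 X).2)) = - dcot 𝕜 g z (ofComps 𝕜 z 0 (comps 𝕜 X).2) := by
    have e : ofComps 𝕜 z 0 (-(comps 𝕜 X).2) = - ofComps 𝕜 z 0 (comps 𝕜 X).2 := by
      exact Prod.ext neg_zero.symm rfl
    rw [e]
    exact map_neg (mfderiv (cotModel 𝕜 E) 𝓘(𝕜, 𝕜) g z : CotTangent 𝕜 z →L[𝕜] 𝕜) _
  rw [poisson, ← h1, h2, h4, h3]
  simp [omega, comps, ofComps]

end Basic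

/-! ### Lie algebroids -/

section Algebroid

variable (𝕜 : Type*) [RCLike 𝕜] (E : Type*) [NormedAddCommGroup E] [NormedSpace 𝕜 E]
  {M : Type*} [TopologicalSpace M] [ChartedSpace E M] [IsManifold 𝓘(𝕜, E) ∞ M]
  (F : Type*) [NormedAddCommGroup F] [NormedSpace 𝕜 F]
  {A : M → Type*} [∀ x, AddCommGroup (A x)] [∀ x, Module 𝕜 (A x)] [∀ x, TopologicalSpace (A x)]
  [TopologicalSpace (TotalSpace F A)] [FiberBundle F A]

/-- `σ` is a smooth section of the bundle `A` over `U`. The values of `σ` outside `U` are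
irrelevant. -/
def SecOn (σ : Π x : M, A x) (U : Set M) : Prop :=
  ContMDiffOn 𝓘(𝕜, E) (𝓘(𝕜, E).prod 𝓘(𝕜, F)) ∞ (fun x => TotalSpace.mk' F x (σ x)) U

variable [VectorBundle 𝕜 F A]

/-- The fibre `Aₓ*` of the dual bundle. -/
abbrev Dual (A : M → Type*) [∀ x, AddCommGroup (A x)] [∀ x, Module 𝕜 (A x)]
    [∀ x, TopologicalSpace (A x)] (x : M) : Type _ := A x →L[𝕜] 𝕜

/-- `c` is a smooth section of the dual bundle `A*` over `U`. -/
def DualOn (c : Π x : M, Dual 𝕜 A x) (U : Set M) : Prop :=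
  ContMDiffOn 𝓘(𝕜, E) (𝓘(𝕜, E).prod 𝓘(𝕜, F →L[𝕜] 𝕜)) ∞
    (fun x => TotalSpace.mk' (F →L[𝕜] 𝕜) (E := fun x : M => Dual 𝕜 A x) x (c x)) U

variable (A)

/-- A Lie algebroid structure on the vector bundle `A`: a bundle map to the tangent bundle and a Lie
bracket on the sheaf of sections of `A`. `bracket σ τ` is meaningful over every open set over which
both `σ` and `τ` are smooth, and only its values there are constrained. -/
structure LieAlgebroid where
  anchor : Π x : M, A x →L[𝕜] TangentSpace 𝓘(𝕜, E) x
  bracket : (Π x : M, A x) → (Π x : M, A x) → Π x : M, A x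
  anchor_smooth : ContMDiff 𝓘(𝕜, E) (𝓘(𝕜, E).prod 𝓘(𝕜, F →L[𝕜] E)) ∞
    (fun x => TotalSpace.mk' (F →L[𝕜] E)
      (E := fun x : M => A x →L[𝕜] TangentSpace 𝓘(𝕜, E) x) x (anchor x))
  bracket_congr : ∀ W : Set M, IsOpen W → ∀ σ σ' τ τ' : Π x : M, A x,
    SecOn 𝕜 E F σ W → SecOn 𝕜 E F τ W → (∀ x ∈ W, σ x = σ' x) → (∀ x ∈ W, τ x = τ' x) →
      ∀ x ∈ W, bracket σ τ x = bracket σ' τ' x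
  bracket_smooth : ∀ W : Set M, IsOpen W → ∀ σ τ : Π x : M, A x,
    SecOn 𝕜 E F σ W → SecOn 𝕜 E F τ W → SecOn 𝕜 E F (bracket σ τ) W
  bracket_add : ∀ W : Set M, IsOpen W → ∀ σ τ τ' : Π x : M, A x,
    SecOn 𝕜 E F σ W → SecOn 𝕜 E F τ W → SecOn 𝕜 E F τ' W →
      ∀ x ∈ W, bracket σ (fun y => τ y + τ' y) x = bracket σ τ x + bracket σ τ' x
  bracket_skew : ∀ W : Set M, IsOpen W → ∀ σ τ : Π x : M, A x,
    SecOn 𝕜 E F σ W → SecOn 𝕜 E F τ W → ∀ x ∈ W, bracket σ τ x = -bracket τ σ x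
  jacobi : ∀ W : Set M, IsOpen W → ∀ σ τ υ : Π x : M, A x,
    SecOn 𝕜 E F σ W → SecOn 𝕜 E F τ W → SecOn 𝕜 E F υ W → ∀ x ∈ W,
      bracket σ (bracket τ υ) x + bracket τ (bracket υ σ) x + bracket υ (bracket σ τ) x = 0
  anchor_bracket : ∀ W : Set M, IsOpen W → ∀ σ τ : Π x : M, A x,
    SecOn 𝕜 E F σ W → SecOn 𝕜 E F τ W → ∀ x ∈ W,
      anchor x (bracket σ τ x) =
        mlieBracket 𝓘(𝕜, E) (fun y => anchor y (σ y)) (fun y => anchor y (τ y)) x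
  leibniz : ∀ W : Set M, IsOpen W → ∀ (σ τ : Π x : M, A x) (f : M → 𝕜),
    SecOn 𝕜 E F σ W → SecOn 𝕜 E F τ W → FunOn 𝕜 E f W → ∀ x ∈ W,
      bracket σ (fun y => f y • τ y) x =
        f x • bracket σ τ x + along 𝕜 E f x (anchor x (σ x)) • τ x

variable {𝕜 E F A} (L : LieAlgebroid 𝕜 E F A)

/-- The anchor action `δ_ε f` on functions, at the point `x`. -/
def LieAlgebroid.act (ε : Π x : M, A x) (f : M → 𝕜) (x : M) : 𝕜 :=
  along 𝕜 E f x (L.anchor x (ε x))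

/-- The coboundary `s f` of a function, `(s f)(ε) = δ_ε f`. -/
def LieAlgebroid.d0 (f : M → 𝕜) (x : M) : Dual 𝕜 A x := (dfun 𝕜 E f x).comp (L.anchor x)

/-- `s c = 0` on `U`, where `s c(ε₁, ε₂) = δ_ε₁ c(ε₂) - δ_ε₂ c(ε₁) - c(⌊ε₁, ε₂⌋)`. -/
def LieAlgebroid.CocycleOn (c : Π x : M, Dual 𝕜 A x) (U : Set M) : Prop :=
  ∀ W : Set M, IsOpen W → W ⊆ U → ∀ σ τ : Π x : M, A x,
    SecOn 𝕜 E F σ W → SecOn 𝕜 E F τ W → ∀ x ∈ W,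
      L.act σ (fun y => c y (τ y)) x - L.act τ (fun y => c y (σ y)) x
        - c x (L.bracket σ τ x) = 0

/-! ### The first cohomology group -/

variable {ι : Type*} (U : ι → Opens M)

variable (𝕜 A) in
/-- Pairs `(c_α(x; ε), c_αβ(x))` of a family of one-cochains on the `U α` and a family of functions
on the `U α ∩ U β`. Values outside these sets are junk, and are disregarded by `cocycles` and
`coboundaries`. -/
abbrev Cochain (ι : Type*) : Type _ := (ι → Π x : M, Dual 𝕜 A x) × (ι → ι → M → 𝕜)

/-- The conditions for `(c_α, c_αβ)` to be a one-cocycle of the total complex of the bicomplex of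
Čech cochains of the cover `U` with values in the complex `𝒪 → Γ(A*) → Γ(∧²A*) → ⋯`. -/
structure LieAlgebroid.IsCocycle (z : Cochain 𝕜 A ι) : Prop where
  smooth_one : ∀ α, DualOn 𝕜 E F (z.1 α) (U α)
  smooth_two : ∀ α β, FunOn 𝕜 E (z.2 α β) (U α ∩ U β)
  closed : ∀ α, L.CocycleOn (z.1 α) (U α)
  mixed : ∀ α β, ∀ x ∈ (U α ∩ U β : Set M), L.d0 (z.2 α β) x = -z.1 α x + z.1 β x
  cech : ∀ α β γ, ∀ x ∈ (U α ∩ U β ∩ U γ : Set M), z.2 α γ x = z.2 α β x + z.2 β γ x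

theorem FunOn.mdiffAt {f : M → 𝕜} {W : Set M} (hf : FunOn 𝕜 E f W) (hW : IsOpen W) {x : M}
    (hx : x ∈ W) : MDifferentiableAt 𝓘(𝕜, E) 𝓘(𝕜, 𝕜) f x :=
  ((hf x hx).contMDiffAt (hW.mem_nhds hx)).mdifferentiableAt (by simp)

theorem DualOn.pair {c : Π x : M, Dual 𝕜 A x} {σ : Π x : M, A x} {W : Set M}
    (hc : DualOn 𝕜 E F c W) (hσ : SecOn 𝕜 E F σ W) : FunOn 𝕜 E (fun x => c x (σ x)) W := by
  intro x hx
  have : ContMDiffWithinAt 𝓘(𝕜, E) (𝓘(𝕜, E).prod 𝓘(𝕜, 𝕜)) ∞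
      (fun m ↦ TotalSpace.mk' 𝕜 (E := Bundle.Trivial M 𝕜) m (c m (σ m))) W x :=
    ContMDiffWithinAt.clm_bundle_apply (F₁ := F) (hc x hx) (hσ x hx)
  rw [contMDiffWithinAt_totalSpace] at this
  exact this.2

theorem dfun_add {f g : M → 𝕜} {W : Set M} (hW : IsOpen W) (hf : FunOn 𝕜 E f W)
    (hg : FunOn 𝕜 E g W) {x : M} (hx : x ∈ W) :
    dfun 𝕜 E (fun y => f y + g y) x = dfun 𝕜 E f x + dfun 𝕜 E g x :=
  mfderiv_add (hf.mdiffAt hW hx) (hg.mdiffAt hW hx)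

theorem dfun_neg (f : M → 𝕜) (x : M) : dfun 𝕜 E (fun y => -f y) x = -dfun 𝕜 E f x :=
  mfderiv_neg

theorem dfun_zero (x : M) : dfun 𝕜 E (fun _ => (0 : 𝕜)) x = 0 :=
  mfderiv_const

/-- The group of one-cocycles. -/
def LieAlgebroid.cocycles : AddSubgroup (Cochain 𝕜 A ι) where
  carrier := {z | L.IsCocycle U z}
  zero_mem' := by
    refine ⟨fun α => ?_, fun α β => contMDiffOn_const, fun α W hW _ σ τ _ _ x _ => ?_,
      fun α β x _ => ?_, fun α β γ x _ => ?_⟩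
    · exact fun x _ => (contMDiff_zeroSection 𝕜 (fun x : M => Dual 𝕜 A x) x).contMDiffWithinAt
    · simp [LieAlgebroid.act, along, dfun_zero]
    · change (dfun 𝕜 E (fun _ => (0 : 𝕜)) x).comp (L.anchor x) = _
      rw [dfun_zero]
      simp
    · simp
  add_mem' := by
    intro z w hz hw
    refine ⟨fun α => ?_, fun α β => (hz.smooth_two α β).add (hw.smooth_two α β),
      fun α W hW hWU σ τ hσ hτ x hx => ?_, fun α β x hx => ?_, fun α β γ x hx => ?_⟩
    · exact ContMDiffOn.add_section (hz.smooth_one α) (hw.smooth_one α)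
    · have h1 := hz.closed α W hW hWU σ τ hσ hτ x hx
      have h2 := hw.closed α W hW hWU σ τ hσ hτ x hx
      have e : ∀ υ : Π x : M, A x, SecOn 𝕜 E F υ W →
          dfun 𝕜 E (fun y => (z + w).1 α y (υ y)) x
            = dfun 𝕜 E (fun y => z.1 α y (υ y)) x + dfun 𝕜 E (fun y => w.1 α y (υ y)) x :=
        fun υ hυ => dfun_add hW (DualOn.pair (ContMDiffOn.mono (hz.smooth_one α) hWU) hυ)
          (DualOn.pair (ContMDiffOn.mono (hw.smooth_one α) hWU) hυ) hx
      simp only [LieAlgebroid.act, along] at h1 h2 ⊢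
      rw [e σ hσ, e τ hτ]
      simp only [_root_.add_apply, Prod.fst_add, Pi.add_apply]
      linear_combination h1 + h2
    · have h1 := hz.mixed α β x hx
      have h2 := hw.mixed α β x hx
      have e : L.d0 ((z + w).2 α β) x = L.d0 (z.2 α β) x + L.d0 (w.2 α β) x := by
        have := dfun_add ((U α).isOpen.inter (U β).isOpen) (hz.smooth_two α β)
          (hw.smooth_two α β) hx
        change (dfun 𝕜 E (fun y => z.2 α β y + w.2 α β y) x).comp (L.anchor x) = _
        rw [this]
        rfl
      rw [e, h1, h2]
      simp only [Prod.fst_add, Pi.add_apply]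
      abel
    · have h1 := hz.cech α β γ x hx
      have h2 := hw.cech α β γ x hx
      simp only [Prod.snd_add, Pi.add_apply]
      linear_combination h1 + h2
  neg_mem' := by
    intro z hz
    refine ⟨fun α => ?_, fun α β => (hz.smooth_two α β).neg,
      fun α W hW hWU σ τ hσ hτ x hx => ?_, fun α β x hx => ?_, fun α β γ x hx => ?_⟩
    · exact ContMDiffOn.neg_section (hz.smooth_one α)
    · have h1 := hz.closed α W hW hWU σ τ hσ hτ x hx
      have e : ∀ υ : Π x : M, A x, dfun 𝕜 E (fun y => (-z).1 α y (υ y)) x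
            = -dfun 𝕜 E (fun y => z.1 α y (υ y)) x := fun υ => dfun_neg _ x
      simp only [LieAlgebroid.act, along] at h1 ⊢
      rw [e σ, e τ]
      simp only [_root_.neg_apply, Prod.fst_neg, Pi.neg_apply]
      linear_combination -h1
    · have h1 := hz.mixed α β x hx
      have e : L.d0 ((-z).2 α β) x = -L.d0 (z.2 α β) x := by
        change (dfun 𝕜 E (fun y => -z.2 α β y) x).comp (L.anchor x) = _
        rw [dfun_neg]
        rfl
      rw [e, h1]
      simp only [Prod.fst_neg, Pi.neg_apply]
      abel
    · have h1 := hz.cech α β γ x hx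
      simp only [Prod.snd_neg, Pi.neg_apply]
      linear_combination -h1

/-- The group of one-coboundaries: the pairs `(s f_α, f_β - f_α)` with `f_α ∈ 𝒪(U α)`. -/
def LieAlgebroid.coboundaries : AddSubgroup (Cochain 𝕜 A ι) where
  carrier := {z | ∃ f : ι → M → 𝕜, (∀ α, FunOn 𝕜 E (f α) (U α)) ∧
    (∀ α, ∀ x ∈ U α, z.1 α x = L.d0 (f α) x) ∧
    ∀ α β, ∀ x ∈ (U α ∩ U β : Set M), z.2 α β x = f β x - f α x}
  zero_mem' := by
    refine ⟨fun _ _ => 0, fun α => contMDiffOn_const, fun α x _ => ?_, fun α β x _ => by simp⟩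
    rw [LieAlgebroid.d0, dfun_zero]
    simp
  add_mem' := by
    rintro z w ⟨f, hf, hf1, hf2⟩ ⟨g, hg, hg1, hg2⟩
    refine ⟨fun α x => f α x + g α x, fun α => (hf α).add (hg α), fun α x hx => ?_,
      fun α β x hx => ?_⟩
    · rw [LieAlgebroid.d0, dfun_add (U α).isOpen (hf α) (hg α) hx]
      simp only [Prod.fst_add, Pi.add_apply, hf1 α x hx, hg1 α x hx]
      rfl
    · simp only [Prod.snd_add, Pi.add_apply, hf2 α β x hx, hg2 α β x hx]
      ring
  neg_mem' := by
    rintro z ⟨f, hf, hf1, hf2⟩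
    refine ⟨fun α x => -f α x, fun α => (hf α).neg, fun α x hx => ?_, fun α β x hx => ?_⟩
    · rw [LieAlgebroid.d0, dfun_neg]
      simp only [Prod.fst_neg, Pi.neg_apply, hf1 α x hx]
      rfl
    · simp only [Prod.snd_neg, Pi.neg_apply, hf2 α β x hx]
      ring

/-- The cohomology group `H¹(A, 𝒪(M))`, computed by means of the open cover `U`. For the cover of
`M` by the single set `M` this is the group of global one-cocycles modulo the `s f`, `f ∈ 𝒪(M)`. -/
abbrev LieAlgebroid.H1 : Type _ :=
  L.cocycles U ⧸ (L.coboundaries U).addSubgroupOf (L.cocycles U)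

/-- The cohomology class of a one-cocycle. -/
def LieAlgebroid.cls (z : Cochain 𝕜 A ι) (hz : L.IsCocycle U z) : L.H1 U :=
  QuotientAddGroup.mk ⟨z, hz⟩

end Algebroid

/-! ### Affine spaces over the cotangent bundle -/

section Affine

variable (𝕜 : Type*) [RCLike 𝕜] (E : Type*) [NormedAddCommGroup E] [NormedSpace 𝕜 E]
  {M : Type*} [TopologicalSpace M] [ChartedSpace E M] [IsManifold 𝓘(𝕜, E) ∞ M]
  {ι : Type*} (U : ι → Opens M)

/-- An affine space `R/T*M`, glued from the `T*(U α)` by the translations `ξ_α = ξ_β + ς_αβ` with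
closed one-forms `ς_αβ`, written `trans α β`, on the intersections `U α ∩ U β`. -/
structure AffineSpace where
  cover : IsOpenCover U
  trans : ι → ι → Π x : M, Cot 𝕜 E x
  smooth : ∀ α β, FormOn 𝕜 E (trans α β) (U α ∩ U β)
  closed : ∀ α β, ClosedOn 𝕜 E (trans α β) (U α ∩ U β)
  cocycle : ∀ α β γ, ∀ x ∈ (U α ∩ U β ∩ U γ : Set M),
    trans α β x + trans β γ x = trans α γ x

variable {𝕜 E U} (R : AffineSpace 𝕜 E U)

namespace AffineSpace

/-- The fibre `Rₓ`: a point of it is given by its coordinates `ξ_α ∈ T*ₓM` for all `α` with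
`x ∈ U α`, subject to `ξ_α = ξ_β + ς_αβ(x)`. -/
@[ext] structure Fiber (x : M) where
  coord : {α // x ∈ U α} → Cot 𝕜 E x
  compat : ∀ α β, coord α = coord β + R.trans α.1 β.1 x

/-- The point of `Rₓ` with coordinate `ξ_α = ξ`. -/
def point (α : ι) {x : M} (hx : x ∈ U α) (ξ : Cot 𝕜 E x) : R.Fiber x :=
  ⟨fun β => ξ + R.trans β.1 α x, fun β γ => by
    rw [add_assoc, add_comm (R.trans γ.1 α x), R.cocycle β.1 γ.1 α x ⟨⟨β.2, γ.2⟩, hx⟩]⟩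

theorem exists_index (R : AffineSpace 𝕜 E U) (x : M) : Nonempty {α // x ∈ U α} := by
  obtain ⟨α, hα⟩ := IsOpenCover.exists_mem R.cover x
  exact ⟨⟨α, hα⟩⟩

/-- `Rₓ` is an affine space over `T*ₓM`. -/
instance torsor (x : M) : AddTorsor (Cot 𝕜 E x) (R.Fiber x) where
  vadd p r := ⟨fun α => p + r.coord α, fun α β => by
    rw [r.compat α β, add_assoc]⟩
  zero_vadd r := Fiber.ext <| funext fun α => zero_add (r.coord α)
  add_vadd p q r := Fiber.ext <| funext fun α => add_assoc p q (r.coord α)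
  vsub r s := r.coord (R.exists_index x).some - s.coord (R.exists_index x).some
  nonempty := ⟨R.point _ (R.exists_index x).some.2 0⟩
  vsub_vadd' r s := Fiber.ext <| funext fun α => by
    change r.coord (R.exists_index x).some - s.coord (R.exists_index x).some + s.coord α = r.coord α
    rw [r.compat _ α, s.compat _ α]
    abel
  vadd_vsub' p r := by
    change p + r.coord (R.exists_index x).some - r.coord (R.exists_index x).some = p
    abel

open Classical in
/-- A section `s` of `R` in the coordinate `ξ_α`: a one-form on `U α` (continued by zero). -/
def localForm (s : Π x : M, R.Fiber x) (α : ι) (x : M) : Cot 𝕜 E x :=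
  if hx : x ∈ U α then (s x).coord ⟨α, hx⟩ else 0

/-- `s` is a smooth section of `R` over `W`. -/
def SectionOn (s : Π x : M, R.Fiber x) (W : Set M) : Prop :=
  ∀ α, FormOn 𝕜 E (R.localForm s α) (W ∩ U α)

end AffineSpace

variable {F : Type*} [NormedAddCommGroup F] [NormedSpace 𝕜 F]
  {A : M → Type*} [∀ x, AddCommGroup (A x)] [∀ x, Module 𝕜 (A x)] [∀ x, TopologicalSpace (A x)]
  [TopologicalSpace (TotalSpace F A)] [FiberBundle F A] [VectorBundle 𝕜 F A]

/-- A fibrewise map `R → A*` (a moment map). It is the same as the family of the functions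
`h_ε(r) = ⟨μ(r)|ε(x)⟩`, `r ∈ Rₓ`, on `R`, which depends `𝒪(M)`-linearly on the section `ε`. -/
abbrev Moment (A : M → Type*) [∀ x, AddCommGroup (A x)] [∀ x, Module 𝕜 (A x)]
    [∀ x, TopologicalSpace (A x)] : Type _ := Π x : M, R.Fiber x → Dual 𝕜 A x

variable {R}

namespace Moment

open Classical in
/-- A moment map in the coordinates `(x, ξ_α)`, on `T*(U α)` (continued by zero). -/
def loc (μ : Moment R A) (α : ι) (z : CotBundle 𝕜 E M) : Dual 𝕜 A z.1 :=
  if hx : z.1 ∈ U α then μ z.1 (R.point α hx z.2) else 0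

/-- The Hamiltonian `h_ε` in the coordinates `(x, ξ_α)`. -/
def ham (μ : Moment R A) (ε : Π x : M, A x) (α : ι) (z : CotBundle 𝕜 E M) : 𝕜 :=
  μ.loc α z (ε z.1)

end Moment

variable (L : LieAlgebroid 𝕜 E F A)

/-- `μ` lifts the anchor action of the Lie algebroid to a Hamiltonian action on `R`: the Hamiltonian
vector field of `h_ε` exists and covers `δ_ε`, and `ε ↦ h_ε` respects the brackets. The symplectic
form of `R` is the canonical form `⟨dξ_α ∧ dx⟩` in each of the coordinates `ξ_α`. -/
structure IsHamiltonianLift (μ : Moment R A) : Prop where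
  smooth : ∀ α, ContMDiffOn (cotModel 𝕜 E) (𝓘(𝕜, E).prod 𝓘(𝕜, F →L[𝕜] 𝕜)) ∞
    (fun z : CotBundle 𝕜 E M => TotalSpace.mk' (F →L[𝕜] 𝕜) (E := fun x : M => Dual 𝕜 A x) z.1
      (Moment.loc μ α z)) {z | z.1 ∈ U α}
  covers : ∀ (W : Set M) (ε : Π x : M, A x), IsOpen W → SecOn 𝕜 E F ε W →
    ∀ (α : ι) (z : CotBundle 𝕜 E M), z.1 ∈ W → z.1 ∈ U α →
      ∃ X : CotTangent 𝕜 z, IsHamAt 𝕜 (Moment.ham μ ε α) z X ∧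
        mfderiv (cotModel 𝕜 E) 𝓘(𝕜, E) (fun w : CotBundle 𝕜 E M => w.1) z X
          = L.anchor z.1 (ε z.1)
  bracket : ∀ (W : Set M) (ε₁ ε₂ : Π x : M, A x), IsOpen W →
    SecOn 𝕜 E F ε₁ W → SecOn 𝕜 E F ε₂ W →
    ∀ (α : ι) (z : CotBundle 𝕜 E M), z.1 ∈ W → z.1 ∈ U α →
      poisson 𝕜 (Moment.ham μ ε₁ α) (Moment.ham μ ε₂ α) z
        = Moment.ham μ (L.bracket ε₁ ε₂) α z

/-- In every coordinate `ξ_α` the Hamiltonians are `h_ε = ⟨δ_ε|ξ_α⟩ + c_α(x; ε)`. -/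
def HasForm (μ : Moment R A) (c : ι → Π x : M, Dual 𝕜 A x) : Prop :=
  ∀ (α : ι) (x : M) (hx : x ∈ U α) (ξ : Cot 𝕜 E x) (a : A x),
    μ x (R.point α hx ξ) a = ξ (L.anchor x a) + c α x a

/-! ### Equivalence of lifts -/

/-- A lift of the anchor action to an affine space obtained from `R` by a twist: the transition
forms of the new affine space are `ς_αβ + dc_αβ`, where the `c_αβ ∈ 𝒪(U α ∩ U β)`, written
`pot α β`, form a Čech cocycle. -/
structure TwistedLift (R : AffineSpace 𝕜 E U) (L : LieAlgebroid 𝕜 E F A) where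
  pot : ι → ι → M → 𝕜
  pot_smooth : ∀ α β, FunOn 𝕜 E (pot α β) (U α ∩ U β)
  pot_cocycle : ∀ α β γ, ∀ x ∈ (U α ∩ U β ∩ U γ : Set M), pot α γ x = pot α β x + pot β γ x
  space : AffineSpace 𝕜 E U
  trans_eq : ∀ α β, ∀ x ∈ (U α ∩ U β : Set M),
    space.trans α β x = R.trans α β x + dfun 𝕜 E (pot α β) x
  moment : Moment space A
  isLift : IsHamiltonianLift L moment

/-- Two twisted lifts are equivalent if there are functions `f_α ∈ 𝒪(U α)` such that
`c'_αβ = c_αβ + f_β - f_α` and such that the isomorphism `ξ'_α = ξ_α - df_α` of the affine spaces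
identifies the Hamiltonians. -/
def TwistedLift.Equivalent {L : LieAlgebroid 𝕜 E F A} (T T' : TwistedLift R L) : Prop :=
  ∃ f : ι → M → 𝕜, (∀ α, FunOn 𝕜 E (f α) (U α)) ∧
    (∀ α β, ∀ x ∈ (U α ∩ U β : Set M), T'.pot α β x = T.pot α β x + (f β x - f α x)) ∧
    ∀ (x : M) (r : T.space.Fiber x) (r' : T'.space.Fiber x),
      (∀ α, r'.coord α = r.coord α - dfun 𝕜 E (f α.1) x) → T'.moment x r' = T.moment x r

/-- Two lifts to the same affine space `R` are equivalent if they differ by a translation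
`ξ ↦ ξ - df` of `R` with `f ∈ 𝒪(M)`. -/
def ShiftEquivalent (μ μ' : Moment R A) : Prop :=
  ∃ f : M → 𝕜, FunOn 𝕜 E f univ ∧
    ∀ (x : M) (r : R.Fiber x), μ' x (-dfun 𝕜 E f x +ᵥ r) = μ x r

end Affine

end Algd

end

noncomputable section

namespace Algd

set_option linter.unusedSectionVars false

/-! Everything rests on the Poisson geometry of functions `⟨V|ξ⟩ + g(x)` on `T*M`, called `affHam V
g`. Such a function has a Hamiltonian field covering `V`, and `{⟨V₁|ξ⟩ + g₁, ⟨V₂|ξ⟩ + g₂} = ⟨[V₁,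
V₂]|ξ⟩ + V₁g₂ - V₂g₁` (`poisson_affHam`). With `V = δ_ε` and `g = c_α(ε)` the terms linear in `ξ`
match because the anchor respects brackets, and the terms free of `ξ` match exactly when `c_α`
satisfies the first cocycle equation. Conversely, covering `δ_ε` means `∂h_ε/∂ξ = δ_ε`, which forces
`h_ε` to be affine along the fibres (`IsHamiltonianLift.hasForm`). Comparing two coordinates `ξ_α`,
`ξ_β` of one point gives the gluing condition on the `c_α` (`IsHamiltonianLift.form_spec`).

The derivatives along the base are reduced to calculus on `M`. Near a point `(x, ξ)` take the
function `f = linCoord` which is linear in the chart and has `df = ξ` at `x`. The section `df` of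
`T*M` has constant momentum in the chart, so `∂/∂x` is differentiation along it, and `⟨V|ξ⟩`
restricts to `df(V)`. The bracket formula, like the formula for the Lie derivative of a section, is
then `d(df) = 0` (`mlieBracket_dfun`).

The remaining claims are linear algebra over this normal form. The covector `ρ_ε ξ` is independent
of `α` by Cartan's formula and the closedness of the transition forms. A difference of two lifts
loses the term `⟨δ_ε|ξ⟩` and is a one-cocycle, whose mixed equation is the difference of two gluing
conditions. A shift `ξ' = ξ - df` changes `c` by `δ_ε f`, a coboundary. -/

theorem dual_inCoordinates {𝕜 : Type*} [RCLike 𝕜] {M : Type*} [TopologicalSpace M]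
    {F : Type*} [NormedAddCommGroup F] [NormedSpace 𝕜 F]
    {A : M → Type*} [∀ x, AddCommGroup (A x)] [∀ x, Module 𝕜 (A x)] [∀ x, TopologicalSpace (A x)]
    [TopologicalSpace (TotalSpace F A)] [FiberBundle F A] [VectorBundle 𝕜 F A] (x₀ x : M)
    (c : A x →L[𝕜] 𝕜) :
    ContinuousLinearMap.inCoordinates F A 𝕜 (fun _ : M => 𝕜) x₀ x x₀ x c
      = c.comp ((trivializationAt F A x₀).symmL 𝕜 x) := by
  rw [ContinuousLinearMap.inCoordinates]
  have : (trivializationAt 𝕜 (fun _ : M => 𝕜) x₀).continuousLinearMapAt 𝕜 x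
      = ContinuousLinearMap.id 𝕜 𝕜 :=
    Bundle.Trivial.continuousLinearMapAt_trivialization 𝕜 M 𝕜 x
  rw [this]
  rfl

/-! ### Differentials of functions and the identity `d(df) = 0` -/

section Calculus

variable {𝕜 : Type*} [RCLike 𝕜] {E : Type*} [NormedAddCommGroup E] [NormedSpace 𝕜 E]
  {M : Type*} [TopologicalSpace M] [ChartedSpace E M] [IsManifold 𝓘(𝕜, E) ∞ M]

theorem along_eq_fderiv {f : M → 𝕜} {x : M} (hf : MDifferentiableAt 𝓘(𝕜, E) 𝓘(𝕜, 𝕜) f x)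
    (v : TangentSpace 𝓘(𝕜, E) x) :
    along 𝕜 E f x v
      = fderiv 𝕜 (f ∘ (extChartAt 𝓘(𝕜, E) x).symm) (extChartAt 𝓘(𝕜, E) x x) v := by
  have h : dfun 𝕜 E f x
      = fderivWithin 𝕜 (writtenInExtChartAt 𝓘(𝕜, E) 𝓘(𝕜, 𝕜) x f) (range 𝓘(𝕜, E))
          (extChartAt 𝓘(𝕜, E) x x) := hf.mfderiv
  have e : writtenInExtChartAt 𝓘(𝕜, E) 𝓘(𝕜, 𝕜) x f = f ∘ (extChartAt 𝓘(𝕜, E) x).symm := by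
    rfl
  rw [e, ModelWithCorners.range_eq_univ, fderivWithin_univ] at h
  rw [along, h]
  rfl

theorem dfun_congr {f g : M → 𝕜} {W : Set M} (hW : IsOpen W) (h : ∀ x ∈ W, f x = g x) {x : M}
    (hx : x ∈ W) : dfun 𝕜 E f x = dfun 𝕜 E g x :=
  Filter.EventuallyEq.mfderiv_eq (Filter.eventuallyEq_of_mem (hW.mem_nhds hx) h)

theorem along_congr {f g : M → 𝕜} {W : Set M} (hW : IsOpen W) (h : ∀ x ∈ W, f x = g x) {x : M}
    (hx : x ∈ W) (v : TangentSpace 𝓘(𝕜, E) x) : along 𝕜 E f x v = along 𝕜 E g x v := by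
  rw [along, along, dfun_congr hW h hx]

theorem along_add {f g : M → 𝕜} {W : Set M} (hW : IsOpen W) (hf : FunOn 𝕜 E f W)
    (hg : FunOn 𝕜 E g W) {x : M} (hx : x ∈ W) (v : TangentSpace 𝓘(𝕜, E) x) :
    along 𝕜 E (fun y => f y + g y) x v = along 𝕜 E f x v + along 𝕜 E g x v := by
  rw [along, dfun_add hW hf hg hx]
  rfl

theorem along_neg (f : M → 𝕜) (x : M) (v : TangentSpace 𝓘(𝕜, E) x) :
    along 𝕜 E (fun y => -f y) x v = -along 𝕜 E f x v := by
  rw [along, dfun_neg]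
  rfl

theorem along_sub {f g : M → 𝕜} {W : Set M} (hW : IsOpen W) (hf : FunOn 𝕜 E f W)
    (hg : FunOn 𝕜 E g W) {x : M} (hx : x ∈ W) (v : TangentSpace 𝓘(𝕜, E) x) :
    along 𝕜 E (fun y => f y - g y) x v = along 𝕜 E f x v - along 𝕜 E g x v := by
  have := along_add hW hf hg.neg hx v
  rw [along_congr hW (g := fun y => f y + -g y) (fun y _ => sub_eq_add_neg _ _) hx v, this]
  change _ + along 𝕜 E (fun y => -g y) x v = _
  rw [along_neg, sub_eq_add_neg]

theorem dfun_sub {f g : M → 𝕜} {W : Set M} (hW : IsOpen W) (hf : FunOn 𝕜 E f W)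
    (hg : FunOn 𝕜 E g W) {x : M} (hx : x ∈ W) :
    dfun 𝕜 E (fun y => f y - g y) x = dfun 𝕜 E f x - dfun 𝕜 E g x :=
  ContinuousLinearMap.ext fun v => along_sub hW hf hg hx v

/-- The derivative of a smooth map is smooth in the coordinates of the two tangent bundles. For the
target `𝕜` the tangent trivialization is the identity, so these are also the coordinates of the
cotangent bundle. -/
theorem FunOn.dfun_formOn {f : M → 𝕜} {W : Set M} (hW : IsOpen W) (hf : FunOn 𝕜 E f W) :
    FormOn 𝕜 E (dfun 𝕜 E f) W := by
  intro x hx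
  refine ContMDiffAt.contMDiffWithinAt ?_
  have h := ((hf x hx).contMDiffAt (hW.mem_nhds hx)).mfderiv_const (m := ∞) (by simp)
  refine (contMDiffAt_hom_bundle _).2 ⟨contMDiffAt_id, ?_⟩
  refine h.congr_of_eventuallyEq (Filter.Eventually.of_forall fun y => ?_)
  refine (dual_inCoordinates x y _).trans (Eq.symm ?_)
  exact congrArg (fun T : 𝕜 →L[𝕜] 𝕜 => T.comp ((dfun 𝕜 E f y).comp
      ((trivializationAt E (TangentSpace 𝓘(𝕜, E)) x).symmL 𝕜 y)))
    (TangentBundle.continuousLinearMapAt_model_space (𝕜 := 𝕜) (f x) (f y))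

theorem FormOn.pair {θ : Π x : M, Cot 𝕜 E x} {Y : Π x : M, TangentSpace 𝓘(𝕜, E) x} {W : Set M}
    (hθ : FormOn 𝕜 E θ W) (hY : FieldOn 𝕜 E Y W) : FunOn 𝕜 E (fun x => θ x (Y x)) W :=
  DualOn.pair hθ hY

/-- Differentiating the pairings on the right produces the two second-derivative terms `D²G(X, Y)`
and `D²G(Y, X)`, which cancel by symmetry. -/
theorem fderiv_lieBracket {E : Type*} [NormedAddCommGroup E] [NormedSpace 𝕜 E] {G : E → 𝕜}
    {X Y : E → E} {e : E} (hG : ContDiffAt 𝕜 ∞ G e) (hX : DifferentiableAt 𝕜 X e)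
    (hY : DifferentiableAt 𝕜 Y e) :
    fderiv 𝕜 G e (fderiv 𝕜 Y e (X e) - fderiv 𝕜 X e (Y e))
      = fderiv 𝕜 (fun e => fderiv 𝕜 G e (Y e)) e (X e)
        - fderiv 𝕜 (fun e => fderiv 𝕜 G e (X e)) e (Y e) := by
  have hG2 : DifferentiableAt 𝕜 (fderiv 𝕜 G) e :=
    (hG.fderiv_right (m := 1) (WithTop.coe_le_coe.2 le_top)).differentiableAt (by simp)
  have hs := hG.isSymmSndFDerivAt
    (by simpa using WithTop.coe_le_coe.2 (le_top : (2 : ℕ∞) ≤ ⊤)) (X e) (Y e)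
  rw [fderiv_clm_apply hG2 hX, fderiv_clm_apply hG2 hY]
  simp [hs]

/-- `d(df) = 0`. -/
theorem mlieBracket_dfun [CompleteSpace E] {f : M → 𝕜}
    {X Y : Π x : M, TangentSpace 𝓘(𝕜, E) x} {W : Set M} (hW : IsOpen W)
    (hf : FunOn 𝕜 E f W) (hX : FieldOn 𝕜 E X W) (hY : FieldOn 𝕜 E Y W) {x : M} (hx : x ∈ W) :
    dfun 𝕜 E f x (mlieBracket 𝓘(𝕜, E) X Y x)
      = along 𝕜 E (fun y => dfun 𝕜 E f y (Y y)) x (X x)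
        - along 𝕜 E (fun y => dfun 𝕜 E f y (X y)) x (Y x) := by
  have h2 : IsManifold 𝓘(𝕜, E) 2 M := inferInstance
  have h1 : IsManifold 𝓘(𝕜, E) 1 M := inferInstance
  set φ := extChartAt 𝓘(𝕜, E) x with hφ
  set G : E → 𝕜 := f ∘ φ.symm with hG
  -- The vector field `Z` written in the chart at `x`, as a map `E → E`.
  let P : (Π x : M, TangentSpace 𝓘(𝕜, E) x) → E → E := fun Z =>
    mpullbackWithin 𝓘(𝕜, E) 𝓘(𝕜, E) φ.symm Z (range 𝓘(𝕜, E))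
  -- The chart expression of `df(Z)` is needed on a neighbourhood, since `key` differentiates it
  -- once more.
  have hGs : ∀ᶠ e in 𝓝 (φ x), ContDiffAt 𝕜 ∞ G e ∧
      ∀ Z : Π x : M, TangentSpace 𝓘(𝕜, E) x,
        dfun 𝕜 E f (φ.symm e) (Z (φ.symm e)) = fderiv 𝕜 G e (P Z e) := by
    have hT : φ.target ∈ 𝓝 (φ x) := extChartAt_target_mem_nhds x
    have hWn : φ.symm ⁻¹' W ∈ 𝓝 (φ x) := by
      apply (continuousAt_extChartAt_symm x).preimage_mem_nhds
      rw [extChartAt_to_inv]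
      exact hW.mem_nhds hx
    filter_upwards [hT, hWn] with e he heW
    have hfe : ContMDiffAt 𝓘(𝕜, E) 𝓘(𝕜, 𝕜) ∞ f (φ.symm e) :=
      (hf _ heW).contMDiffAt (hW.mem_nhds heW)
    have hs : ContMDiffAt 𝓘(𝕜, E) 𝓘(𝕜, E) ∞ φ.symm e :=
      (contMDiffOn_extChartAt_symm x).contMDiffAt ((isOpen_extChartAt_target x).mem_nhds he)
    refine ⟨(hfe.comp e hs).contDiffAt, fun Z => ?_⟩
    have hc : mfderiv 𝓘(𝕜, E) 𝓘(𝕜, 𝕜) (f ∘ φ.symm) e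
        = (mfderiv 𝓘(𝕜, E) 𝓘(𝕜, 𝕜) f (φ.symm e)).comp (mfderiv 𝓘(𝕜, E) 𝓘(𝕜, E) φ.symm e) :=
      mfderiv_comp e (hfe.mdifferentiableAt (by simp)) (hs.mdifferentiableAt (by simp))
    have hi := isInvertible_mfderivWithin_extChartAt_symm he
    have hZ : (mfderiv 𝓘(𝕜, E) 𝓘(𝕜, E) φ.symm e) (P Z e) = Z (φ.symm e) := by
      rw [← mfderivWithin_univ]
      have := hi.self_apply_inverse (Z (φ.symm e))
      rw [ModelWithCorners.range_eq_univ] at this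
      simp only [P, ModelWithCorners.range_eq_univ, mpullbackWithin_apply]
      exact this
    rw [← mfderiv_eq_fderiv, hc]
    change _ = mfderiv 𝓘(𝕜, E) 𝓘(𝕜, 𝕜) f (φ.symm e) (mfderiv 𝓘(𝕜, E) 𝓘(𝕜, E) φ.symm e (P Z e))
    rw [hZ]
    rfl
  have key : ∀ Z : Π x : M, TangentSpace 𝓘(𝕜, E) x, FieldOn 𝕜 E Z W →
      DifferentiableAt 𝕜 (P Z) (φ x) ∧ P Z (φ x) = Z x ∧
      ∀ v : E, along 𝕜 E (fun y => dfun 𝕜 E f y (Z y)) x v =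
        fderiv 𝕜 (fun e => fderiv 𝕜 G e (P Z e)) (φ x) v := by
    intro Z hZ
    have hZx := ((hZ x hx).contMDiffAt (hW.mem_nhds hx)).mdifferentiableAt (by simp)
    refine ⟨?_, ?_, fun v => ?_⟩
    · have h : DifferentiableWithinAt 𝕜 (P Z) (φ.symm ⁻¹' univ ∩ range 𝓘(𝕜, E)) (φ x) :=
        (hZx.mdifferentiableWithinAt (s := univ)).differentiableWithinAt_mpullbackWithin_vectorField
      rwa [ModelWithCorners.range_eq_univ, preimage_univ, inter_self,
        differentiableWithinAt_univ] at h
    · have e1 : (Z (φ.symm (φ x)) : E) = Z x := by rw [hφ, extChartAt_to_inv]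
      exact (mfderivWithin_extChartAt_symm_inverse_apply (I := 𝓘(𝕜, E)) (x := x)
        (Z (φ.symm (φ x)) : E)).trans e1
    · refine (along_eq_fderiv (FunOn.mdiffAt ((FunOn.dfun_formOn hW hf).pair hZ) hW hx) v).trans ?_
      refine congrArg (fun T : E →L[𝕜] 𝕜 => T v) (Filter.EventuallyEq.fderiv_eq ?_)
      filter_upwards [hGs] with e he
      exact he.2 Z
  obtain ⟨hXd, hXx, hXa⟩ := key X hX
  obtain ⟨hYd, hYx, hYa⟩ := key Y hY
  -- By definition the bracket is formed in the chart and brought back by the inverse derivative of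
  -- the chart, which at `x` itself is the identity.
  have hb : (mlieBracket 𝓘(𝕜, E) X Y x : E) =
      fderiv 𝕜 (P Y) (φ x) (P X (φ x)) - fderiv 𝕜 (P X) (φ x) (P Y (φ x)) := by
    have e1 : mlieBracket 𝓘(𝕜, E) X Y x = (mfderiv 𝓘(𝕜, E) 𝓘(𝕜, E) φ x).inverse
        ((lieBracketWithin 𝕜 (P X) (P Y) (φ.symm ⁻¹' univ ∩ range 𝓘(𝕜, E)) (φ x) : E) :) := rfl
    have e0 : ∀ T : E →L[𝕜] E, T = .id 𝕜 E → ∀ v, T.inverse v = v := by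
      rintro _ rfl v
      simp
    have e2 : ∀ v : E, ((mfderiv 𝓘(𝕜, E) 𝓘(𝕜, E) φ x).inverse v : E) = v :=
      e0 _ mfderiv_extChartAt_self
    refine (e1.trans (e2 _)).trans ?_
    rw [ModelWithCorners.range_eq_univ, preimage_univ, inter_self, lieBracketWithin_univ]
    rfl
  have hd : ∀ v : E, dfun 𝕜 E f x v = fderiv 𝕜 G (φ x) v := fun v =>
    along_eq_fderiv (hf.mdiffAt hW hx) v
  have h := fderiv_lieBracket hGs.self_of_nhds.1 hXd hYd
  rw [← hb, ← hYa, ← hXa, hXx, hYx] at h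
  exact (hd _).trans h

end Calculus

/-! ### Canonical coordinates on the cotangent bundle -/

section Symplectic

variable {𝕜 : Type*} [RCLike 𝕜] {E : Type*} [NormedAddCommGroup E] [NormedSpace 𝕜 E]
  {M : Type*} [TopologicalSpace M] [ChartedSpace E M] [IsManifold 𝓘(𝕜, E) ∞ M]

instance : IsManifold (cotModel 𝕜 E) ∞ (CotBundle 𝕜 E M) :=
  Bundle.TotalSpace.isManifold (n := ∞) (IB := 𝓘(𝕜, E)) (E →L[𝕜] 𝕜) (fun x : M => Cot 𝕜 E x)

/-- The cotangent bundle is the bundle of homomorphisms from `TM` to the trivial line bundle, so its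
charts transport a covector by the inverse of a trivialization of `TM`. -/
theorem extChartAt_cot (z w : CotBundle 𝕜 E M) :
    extChartAt (cotModel 𝕜 E) z w = (extChartAt 𝓘(𝕜, E) z.1 w.1,
      (w.2 : TangentSpace 𝓘(𝕜, E) w.1 →L[𝕜] 𝕜).comp
        ((trivializationAt E (TangentSpace 𝓘(𝕜, E)) z.1).symmL 𝕜 w.1)) := by
  have h := hom_chart (𝕜 := 𝕜) (HB := E) (F₁ := E)
    (E₁ := fun x : M => TangentSpace 𝓘(𝕜, E) x) (F₂ := 𝕜)
    (E₂ := fun x : M => 𝕜) z w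
  have e : extChartAt (cotModel 𝕜 E) z w =
     chartAt (ModelProd E (E →L[𝕜] 𝕜)) z w := rfl
  rw [e]
  refine h.trans (Prod.ext rfl ?_)
  exact dual_inCoordinates z.1 w.1 w.2

theorem extChartAt_cot_fibre (z : CotBundle 𝕜 E M) (ξ : Cot 𝕜 E z.1) :
    extChartAt (cotModel 𝕜 E) z ⟨z.1, ξ⟩ = (extChartAt 𝓘(𝕜, E) z.1 z.1, ξ) := by
  refine (extChartAt_cot z _).trans (Prod.ext rfl (ContinuousLinearMap.ext fun v => ?_))
  have h := TangentBundle.symmL_trivializationAt (I := 𝓘(𝕜, E)) (mem_chart_source E z.1)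
  have h' := mfderivWithin_range_extChartAt_symm (I := 𝓘(𝕜, E)) (x := z.1)
  exact congrArg (fun T : E →L[𝕜] E => ξ (T v)) (h.trans h')

variable (𝕜 E) in
/-- The function `⟨ξ|x⟩` which is linear in the preferred chart at `x`. -/
def linCoord (x : M) (ξ : E →L[𝕜] 𝕜) (y : M) : 𝕜 := ξ (extChartAt 𝓘(𝕜, E) x y)

theorem linCoord_funOn (x : M) (ξ : E →L[𝕜] 𝕜) :
    FunOn 𝕜 E (linCoord 𝕜 E x ξ) (chartAt E x).source :=
  ξ.contMDiff.comp_contMDiffOn (contMDiffOn_extChartAt (x := x))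

theorem dfun_linCoord {x y : M} (ξ : E →L[𝕜] 𝕜) (hy : y ∈ (chartAt E x).source) :
    dfun 𝕜 E (linCoord 𝕜 E x ξ) y
      = ξ.comp ((trivializationAt E (TangentSpace 𝓘(𝕜, E)) x).continuousLinearMapAt 𝕜 y) := by
  rw [TangentBundle.continuousLinearMapAt_trivializationAt hy]
  refine (mfderiv_comp y ξ.mdifferentiableAt (mdifferentiableAt_extChartAt hy)).trans ?_
  rw [ContinuousLinearMap.mfderiv_eq]
  rfl

theorem dfun_linCoord_self (x : M) (ξ : Cot 𝕜 E x) : dfun 𝕜 E (linCoord 𝕜 E x ξ) x = ξ := by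
  rw [dfun_linCoord (E := E) ξ (mem_chart_source E x),
   TangentBundle.continuousLinearMapAt_trivializationAt (mem_chart_source E x),
    mfderiv_extChartAt_self]
  rfl

/-- The exact form `d⟨ξ|x⟩` has constant momentum in the chart at `z`, so moving along it varies `x`
alone. This is what turns `∂/∂x` into a derivative on `M`. -/
theorem extChartAt_cot_linCoord (z : CotBundle 𝕜 E M) {y : M} (hy : y ∈ (chartAt E z.1).source) :
    extChartAt (cotModel 𝕜 E) z ⟨y, dfun 𝕜 E (linCoord 𝕜 E z.1 z.2) y⟩ =
      (extChartAt 𝓘(𝕜, E) z.1 y, z.2) := by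
  refine (extChartAt_cot z _).trans (Prod.ext rfl (ContinuousLinearMap.ext fun v => ?_))
  have h := dfun_linCoord (𝕜 := 𝕜) (E := E) z.2 hy
  let e := trivializationAt E (TangentSpace 𝓘(𝕜, E)) z.1
  refine (congrArg (fun T : E →L[𝕜] 𝕜 => T ((e.symmL 𝕜 y : E →L[𝕜] E) v)) h).trans ?_
  exact congrArg (z.2 : E →L[𝕜] 𝕜) (e.continuousLinearMapAt_symmL hy v)

/-- A map into the cotangent bundle is differentiated in coordinates. -/
theorem mfderiv_cot {E' : Type*} [NormedAddCommGroup E'] [NormedSpace 𝕜 E'] {H' : Type*}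
    [TopologicalSpace H'] {I : ModelWithCorners 𝕜 E' H'} {N : Type*} [TopologicalSpace N]
    [ChartedSpace H' N]
   {g : N → CotBundle 𝕜 E M} {n : N} (hg : MDifferentiableAt I (cotModel 𝕜 E) g n)
   {z : CotBundle 𝕜 E M} (hz : g n = z) (v : TangentSpace I n) :
   comps 𝕜 (z := z) (mfderiv I (cotModel 𝕜 E) g n v : E × (E →L[𝕜] 𝕜))
     = mfderiv I 𝓘(𝕜, E × (E →L[𝕜] 𝕜)) (fun m => extChartAt (cotModel 𝕜 E) z (g m)) n v := by
  subst hz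
  have h := mfderiv_comp n (mdifferentiableAt_extChartAt (I := cotModel 𝕜 E)
    (mem_chart_source _ (g n))) hg
  have h' := mfderiv_extChartAt_self (I := cotModel 𝕜 E) (x := g n)
  exact ((congrArg (fun T : TangentSpace I n →L[𝕜] E × (E →L[𝕜] 𝕜) => T v) h).trans
    (congrArg (fun T : E × (E →L[𝕜] 𝕜) →L[𝕜] E × (E →L[𝕜] 𝕜) =>
      T (mfderiv I (cotModel 𝕜 E) g n v)) h')).symm

theorem mdifferentiableAt_cot_proj (z : CotBundle 𝕜 E M) :
    MDifferentiableAt (cotModel 𝕜 E) 𝓘(𝕜, E) (fun w : CotBundle 𝕜 E M => w.1) z :=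
  (contMDiffAt_proj (n := ∞) (fun x : M => Cot 𝕜 E x)).mdifferentiableAt (by simp)

/-- The derivative of the projection `T*M → M` in canonical coordinates. -/
theorem mfderiv_cot_proj (z : CotBundle 𝕜 E M) (X : CotTangent 𝕜 z) :
    mfderiv (cotModel 𝕜 E) 𝓘(𝕜, E) (fun w : CotBundle 𝕜 E M => w.1) z X = (comps 𝕜 X).1 := by
  have hz : z.1 ∈ (chartAt E z.1).source := mem_chart_source E z.1
  have h1 := mfderiv_comp z (mdifferentiableAt_extChartAt (I := 𝓘(𝕜, E)) hz)
    (mdifferentiableAt_cot_proj z)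
  have h1' := mfderiv_extChartAt_self (I := 𝓘(𝕜, E)) (x := z.1)
  have h2 := mfderiv_comp z (I' := 𝓘(𝕜, E × (E →L[𝕜] 𝕜)))
    (ContinuousLinearMap.fst 𝕜 E (E →L[𝕜] 𝕜)).mdifferentiableAt
    (mdifferentiableAt_extChartAt (I := cotModel 𝕜 E) (mem_chart_source _ z))
  have h2' := mfderiv_extChartAt_self (I := cotModel 𝕜 E) (x := z)
  -- The chart of `T*M` at `z` lies over the chart of `M` at the base point, and both have the
  -- identity as derivative at their centres.
  have e : (extChartAt 𝓘(𝕜, E) z.1 ∘ fun w : CotBundle 𝕜 E M => w.1)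
      = ContinuousLinearMap.fst 𝕜 E (E →L[𝕜] 𝕜) ∘ extChartAt (cotModel 𝕜 E) z := by
    ext w
    exact (congrArg Prod.fst (extChartAt_cot z w)).symm
  rw [e] at h1
  have h3 := h1.symm.trans h2
  have h4 := (congrArg (fun T : CotTangent 𝕜 z →L[𝕜] E => T X) h3)
  refine Eq.trans (congrArg (fun T : E →L[𝕜] E =>
    T (mfderiv (cotModel 𝕜 E) 𝓘(𝕜, E) (fun w : CotBundle 𝕜 E M => w.1) z X)) h1').symm ?_
  refine h4.trans ?_
  rw [ContinuousLinearMap.mfderiv_eq]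
  exact congrArg (fun T : E × (E →L[𝕜] 𝕜) →L[𝕜] E × (E →L[𝕜] 𝕜) => (T X).1) h2'

/-- The chain rule for functions on `T*M`, in canonical coordinates. -/
theorem mfderiv_comp_cot {E' : Type*} [NormedAddCommGroup E'] [NormedSpace 𝕜 E'] {H' : Type*}
    [TopologicalSpace H'] {I : ModelWithCorners 𝕜 E' H'} {N : Type*} [TopologicalSpace N]
    [ChartedSpace H' N] {g : N → CotBundle 𝕜 E M} {n : N}
    (hg : MDifferentiableAt I (cotModel 𝕜 E) g n) {z : CotBundle 𝕜 E M} (hz : g n = z)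
    {h : CotBundle 𝕜 E M → 𝕜} (hh : MDifferentiableAt (cotModel 𝕜 E) 𝓘(𝕜, 𝕜) h z)
    {D : TangentSpace I n →L[𝕜] E × (E →L[𝕜] 𝕜)}
    (hD : HasMFDerivAt I 𝓘(𝕜, E × (E →L[𝕜] 𝕜)) (fun m => extChartAt (cotModel 𝕜 E) z (g m)) n D)
    (v : TangentSpace I n) :
    mfderiv I 𝓘(𝕜, 𝕜) (fun m => h (g m)) n v = dcot 𝕜 h z (ofComps 𝕜 z (D v).1 (D v).2) := by
  subst hz
  have h1 := congrArg (fun T : TangentSpace I n →L[𝕜] 𝕜 => T v) (mfderiv_comp n hh hg)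
  have h2 := mfderiv_cot hg rfl v
  rw [hD.mfderiv] at h2
  refine h1.trans ?_
  exact congrArg (dcot 𝕜 h (g n)) h2

/-- The derivative of a function on `T*M` along a fibre. -/
theorem hasDerivAt_fibre {h : CotBundle 𝕜 E M → 𝕜} {x : M} {ξ : Cot 𝕜 E x}
    (hh : MDifferentiableAt (cotModel 𝕜 E) 𝓘(𝕜, 𝕜) h ⟨x, ξ⟩) (q : Cot 𝕜 E x) :
    HasDerivAt (fun t : 𝕜 => h ⟨x, ξ + t • q⟩) (dcot 𝕜 h ⟨x, ξ⟩ (ofComps 𝕜 ⟨x, ξ⟩ 0 q)) 0 := by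
  have h0 : (⟨x, ξ + (0 : 𝕜) • q⟩ : CotBundle 𝕜 E M) = ⟨x, ξ⟩ :=
    congrArg (TotalSpace.mk x) ((fun a b => by ext; simp :
      ∀ a b : E →L[𝕜] 𝕜, a + (0 : 𝕜) • b = a) ξ q)
  have hg : MDifferentiableAt 𝓘(𝕜, 𝕜) (cotModel 𝕜 E)
      (fun t : 𝕜 => (⟨x, ξ + t • q⟩ : CotBundle 𝕜 E M)) 0 := by
    refine ContMDiffAt.mdifferentiableAt (n := ∞) ?_ (by simp)
    refine (contMDiffAt_hom_bundle _).2 ⟨contMDiffAt_const, ?_⟩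
    have hs : ∀ (a b : E →L[𝕜] 𝕜) (S : E →L[𝕜] E),
        ContDiff 𝕜 ∞ (fun t : 𝕜 => (a + t • b).comp S) := by
      intro a b S
      fun_prop
    exact (hs ξ q _).contMDiff.contMDiffAt.congr_of_eventuallyEq
      (Filter.Eventually.of_forall fun t => dual_inCoordinates x x _)
  have hD : HasMFDerivAt 𝓘(𝕜, 𝕜) 𝓘(𝕜, E × (E →L[𝕜] 𝕜))
      (fun t : 𝕜 => extChartAt (cotModel 𝕜 E) ⟨x, ξ⟩ (⟨x, ξ + t • q⟩ : CotBundle 𝕜 E M)) 0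
      (ContinuousLinearMap.toSpanSingleton 𝕜 ((0 : E), (q : E →L[𝕜] 𝕜))) := by
    have hd : ∀ (e : E) (a b : E →L[𝕜] 𝕜),
        HasDerivAt (fun t : 𝕜 => (e, a + t • b)) ((0 : E), b) 0 := by
      intro e a b
      have := ((hasDerivAt_id (0 : 𝕜)).smul_const b).const_add a
      rw [one_smul] at this
      exact (hasDerivAt_const _ _).prodMk this
    refine (hd (extChartAt 𝓘(𝕜, E) x x) ξ q).hasFDerivAt.hasMFDerivAt.congr_of_eventuallyEq
      (Filter.Eventually.of_forall fun t => ?_)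
    exact extChartAt_cot_fibre ⟨x, ξ⟩ _
  have h1 := mfderiv_comp_cot hg h0 hh hD (1 : 𝕜)
  have h2 : MDifferentiableAt 𝓘(𝕜, 𝕜) 𝓘(𝕜, 𝕜) (fun t : 𝕜 => h ⟨x, ξ + t • q⟩) 0 :=
    MDifferentiableAt.comp (0 : 𝕜) (by rw [h0]; exact hh) hg
  have h3 := h2.differentiableAt.hasDerivAt
  rw [mfderiv_eq_fderiv] at h1
  rw [← fderiv_apply_one_eq_deriv] at h3
  exact h3.congr_deriv (h1.trans (congrArg (fun p : E × (E →L[𝕜] 𝕜) =>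
    dcot 𝕜 h ⟨x, ξ⟩ (ofComps 𝕜 ⟨x, ξ⟩ p.1 p.2)) (one_smul 𝕜 ((0 : E), (q : E →L[𝕜] 𝕜)))))

theorem dfun_linCoord_mdifferentiableAt (x : M) (ξ : E →L[𝕜] 𝕜) :
    MDifferentiableAt 𝓘(𝕜, E) (cotModel 𝕜 E)
      (fun y => (⟨y, dfun 𝕜 E (linCoord 𝕜 E x ξ) y⟩ : CotBundle 𝕜 E M)) x :=
  have hW := (chartAt E x).open_source
  have hz := mem_chart_source E x
  (((linCoord_funOn x ξ).dfun_formOn hW _ hz).contMDiffAt (hW.mem_nhds hz)).mdifferentiableAt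
      (by simp)

/-- The derivative of a function on `T*M` along the base in canonical coordinates. -/
theorem dbase_eq_along {h : CotBundle 𝕜 E M → 𝕜} {z : CotBundle 𝕜 E M}
    (hh : MDifferentiableAt (cotModel 𝕜 E) 𝓘(𝕜, 𝕜) h z) (v : TangentSpace 𝓘(𝕜, E) z.1) :
    dbase 𝕜 h z v = along 𝕜 E (fun y => h ⟨y, dfun 𝕜 E (linCoord 𝕜 E z.1 z.2) y⟩) z.1 v := by
  have hz := mem_chart_source E z.1
  have hz' : (⟨z.1, dfun 𝕜 E (linCoord 𝕜 E z.1 z.2) z.1⟩ : CotBundle 𝕜 E M) = z := by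
    rw [dfun_linCoord_self]
  have h3 : HasMFDerivAt 𝓘(𝕜, E) 𝓘(𝕜, E × (E →L[𝕜] 𝕜))
      (fun y => extChartAt (cotModel 𝕜 E) z
        (⟨y, dfun 𝕜 E (linCoord 𝕜 E z.1 z.2) y⟩ : CotBundle 𝕜 E M)) z.1
      ((mfderiv 𝓘(𝕜, E) 𝓘(𝕜, E) (extChartAt 𝓘(𝕜, E) z.1) z.1).prod 0) := by
    have h4 : ∀ ξ : E →L[𝕜] 𝕜, HasMFDerivAt 𝓘(𝕜, E) 𝓘(𝕜, E × (E →L[𝕜] 𝕜))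
        (fun y => (extChartAt 𝓘(𝕜, E) z.1 y, ξ)) z.1
        ((mfderiv 𝓘(𝕜, E) 𝓘(𝕜, E) (extChartAt 𝓘(𝕜, E) z.1) z.1).prod 0) := fun ξ => by
      have h := (mdifferentiableAt_extChartAt (I := 𝓘(𝕜, E)) hz).hasMFDerivAt
      exact ⟨h.1.prodMk continuousAt_const, h.2.prodMk (hasFDerivWithinAt_const _ _ _)⟩
    refine (h4 z.2).congr_of_eventuallyEq ?_
    filter_upwards [(chartAt E z.1).open_source.mem_nhds hz] with y hy
    exact extChartAt_cot_linCoord z hy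
  have h1 := mfderiv_comp_cot (dfun_linCoord_mdifferentiableAt (E := E) z.1 z.2) hz' hh h3 v
  have e : mfderiv 𝓘(𝕜, E) 𝓘(𝕜, E) (extChartAt 𝓘(𝕜, E) z.1) z.1 v = v :=
    congrArg (fun T : E →L[𝕜] E => T v) mfderiv_extChartAt_self
  refine Eq.trans ?_ h1.symm
  exact congrArg (fun w : E => dcot 𝕜 h z (ofComps 𝕜 z w (0 : E →L[𝕜] 𝕜))) e.symm

end Symplectic

/-! ### Hamiltonians affine along the fibres -/

section AffineHamiltonian

variable {𝕜 : Type*} [RCLike 𝕜] {E : Type*} [NormedAddCommGroup E] [NormedSpace 𝕜 E]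
  {M : Type*} [TopologicalSpace M] [ChartedSpace E M] [IsManifold 𝓘(𝕜, E) ∞ M]

/-- The Hamiltonian `⟨V|ξ⟩ + g(x)`, affine along the fibres of `T*M`. -/
def affHam (V : Π x : M, TangentSpace 𝓘(𝕜, E) x) (g : M → 𝕜) (z : CotBundle 𝕜 E M) : 𝕜 :=
  (z.2 : TangentSpace 𝓘(𝕜, E) z.1 →L[𝕜] 𝕜) (V z.1) + g z.1

theorem isOpen_proj_preimage {W : Set M} (hW : IsOpen W) :
    IsOpen {z : CotBundle 𝕜 E M | z.1 ∈ W} :=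
  hW.preimage (FiberBundle.continuous_proj (E →L[𝕜] 𝕜) (fun x : M => Cot 𝕜 E x))

theorem contMDiff_cot_proj : ContMDiff (cotModel 𝕜 E) 𝓘(𝕜, E) ∞ (fun w : CotBundle 𝕜 E M => w.1) :=
  contMDiff_proj (fun x : M => Cot 𝕜 E x)

variable {V V₁ V₂ : Π x : M, TangentSpace 𝓘(𝕜, E) x} {g g₁ g₂ : M → 𝕜} {W : Set M}

theorem affHam_contMDiffOn (hV : FieldOn 𝕜 E V W) (hg : FunOn 𝕜 E g W) :
    ContMDiffOn (cotModel 𝕜 E) 𝓘(𝕜, 𝕜) ∞ (affHam V g) {z : CotBundle 𝕜 E M | z.1 ∈ W} := by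
  have hp : ContMDiffOn (cotModel 𝕜 E) 𝓘(𝕜, E) ∞ (fun w : CotBundle 𝕜 E M => w.1) {z | z.1 ∈ W} :=
    contMDiff_cot_proj.contMDiffOn
  refine ContMDiffOn.add (fun z hz => ?_) (hg.comp hp fun _ h => h)
  have : ContMDiffWithinAt (cotModel 𝕜 E) (𝓘(𝕜, E).prod 𝓘(𝕜, 𝕜)) ∞
      (fun w : CotBundle 𝕜 E M ↦ TotalSpace.mk' 𝕜 (E := fun _ : M => 𝕜) w.1
        ((w.2 : TangentSpace 𝓘(𝕜, E) w.1 →L[𝕜] 𝕜) (V w.1))) {z | z.1 ∈ W} z :=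
    ContMDiffWithinAt.clm_bundle_apply (F₁ := E) contMDiffWithinAt_id
      ((hV.comp hp fun _ h => h) z hz)
  rw [contMDiffWithinAt_totalSpace] at this
  exact this.2

theorem affHam_mdifferentiableAt (hW : IsOpen W) (hV : FieldOn 𝕜 E V W) (hg : FunOn 𝕜 E g W)
    {z : CotBundle 𝕜 E M} (hz : z.1 ∈ W) :
    MDifferentiableAt (cotModel 𝕜 E) 𝓘(𝕜, 𝕜) (affHam V g) z :=
  ((affHam_contMDiffOn hV hg z hz).contMDiffAt
    ((isOpen_proj_preimage hW).mem_nhds hz)).mdifferentiableAt (by simp)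

/-- On the line `ξ + tq` in a fibre the function is `ξ(V) + t q(V) + g`, with slope `q(V)`. -/
theorem dcot_affHam_fibre (hW : IsOpen W) (hV : FieldOn 𝕜 E V W) (hg : FunOn 𝕜 E g W)
    {z : CotBundle 𝕜 E M} (hz : z.1 ∈ W) (q : Cot 𝕜 E z.1) :
    dcot 𝕜 (affHam V g) z (ofComps 𝕜 z 0 q) = q (V z.1) := by
  have h1 := hasDerivAt_fibre (affHam_mdifferentiableAt hW hV hg hz) q
  have h2 : ∀ (a b v : 𝕜), HasDerivAt (fun t : 𝕜 => (a + t * b) + v) b 0 := fun a b v => by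
    simpa using (((hasDerivAt_id (0 : 𝕜)).mul_const b).const_add a).add_const v
  exact h1.unique (h2 ((z.2 : Cot 𝕜 E z.1) (V z.1)) (q (V z.1)) (g z.1))

/-- Restricted to the section `df` of constant momentum, with `f = linCoord`, the Hamiltonian is the
function `df(V) + g` on `M`. -/
theorem dbase_affHam (hW : IsOpen W) (hV : FieldOn 𝕜 E V W) (hg : FunOn 𝕜 E g W)
    {z : CotBundle 𝕜 E M} (hz : z.1 ∈ W) (v : TangentSpace 𝓘(𝕜, E) z.1) :
    dbase 𝕜 (affHam V g) z v
      = along 𝕜 E (fun y => dfun 𝕜 E (linCoord 𝕜 E z.1 z.2) y (V y)) z.1 v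
        + along 𝕜 E g z.1 v := by
  rw [dbase_eq_along (affHam_mdifferentiableAt hW hV hg hz)]
  have hc := (chartAt E z.1).open_source
  refine along_add (hW.inter hc) ?_ (hg.mono inter_subset_left) ⟨hz, mem_chart_source E z.1⟩ v
  exact FormOn.pair (((linCoord_funOn (E := E) z.1 z.2).dfun_formOn hc).mono inter_subset_right)
    (hV.mono inter_subset_left)

/-- The Hamiltonian vector field of `⟨V|ξ⟩ + g(x)`. -/
theorem affHam_isHamAt (hW : IsOpen W) (hV : FieldOn 𝕜 E V W) (hg : FunOn 𝕜 E g W)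
    {z : CotBundle 𝕜 E M} (hz : z.1 ∈ W) :
    IsHamAt 𝕜 (affHam V g) z (ofComps 𝕜 z (V z.1) (-dbase 𝕜 (affHam V g) z)) := by
  intro Y
  have h1 := dcot_affHam_fibre (E := E) hW hV hg hz (comps 𝕜 Y).2
  have e : Y = ofComps 𝕜 z (comps 𝕜 Y).1 0 + ofComps 𝕜 z 0 (comps 𝕜 Y).2 :=
    Prod.ext (add_zero _).symm (zero_add _).symm
  have h2 : dcot 𝕜 (affHam V g) z Y
      = dbase 𝕜 (affHam V g) z (comps 𝕜 Y).1
        + dcot 𝕜 (affHam V g) z (ofComps 𝕜 z 0 (comps 𝕜 Y).2) := by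
    conv_lhs => rw [e]
    exact map_add (mfderiv (cotModel 𝕜 E) 𝓘(𝕜, 𝕜) (affHam V g) z : CotTangent 𝕜 z →L[𝕜] 𝕜) _ _
  rw [h2, h1, omega]
  change (comps 𝕜 Y).2 (V z.1) - (-dbase 𝕜 (affHam V g) z (comps 𝕜 Y).1) = _
  rw [sub_neg_eq_add, add_comm]
  rfl

theorem poisson_affHam [CompleteSpace E] (hW : IsOpen W) (hV₁ : FieldOn 𝕜 E V₁ W)
    (hV₂ : FieldOn 𝕜 E V₂ W) (hg₁ : FunOn 𝕜 E g₁ W) (hg₂ : FunOn 𝕜 E g₂ W)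
    {z : CotBundle 𝕜 E M} (hz : z.1 ∈ W) :
    poisson 𝕜 (affHam V₁ g₁) (affHam V₂ g₂) z
      = (z.2 : TangentSpace 𝓘(𝕜, E) z.1 →L[𝕜] 𝕜) (mlieBracket 𝓘(𝕜, E) V₁ V₂ z.1)
        + (along 𝕜 E g₂ z.1 (V₁ z.1) - along 𝕜 E g₁ z.1 (V₂ z.1)) := by
  have hc := (chartAt E z.1).open_source
  -- `d(df) = 0` for `f = linCoord`. Since `df` equals `z.2` at the base point, this evaluates `z.2`
  -- on the bracket of the vector fields.
  have h := mlieBracket_dfun (hW.inter hc)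
    ((linCoord_funOn (E := E) z.1 z.2).mono inter_subset_right)
    (hV₁.mono inter_subset_left) (hV₂.mono inter_subset_left) ⟨hz, mem_chart_source E z.1⟩
  have e : dfun 𝕜 E (linCoord 𝕜 E z.1 z.2) z.1 = z.2 := dfun_linCoord_self z.1 z.2
  rw [e] at h
  rw [h, poisson]
  have e1 := dcot_affHam_fibre (E := E) hW hV₁ hg₁ hz (dbase (E := E) 𝕜 (affHam V₂ g₂) z)
  have e2 := dcot_affHam_fibre (E := E) hW hV₂ hg₂ hz (dbase (E := E) 𝕜 (affHam V₁ g₁) z)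
  refine (congrArg₂ (· - ·) e1 e2).trans ?_
  refine (congrArg₂ (· - ·) (dbase_affHam (E := E) hW hV₂ hg₂ hz (V₁ z.1))
    (dbase_affHam (E := E) hW hV₁ hg₁ hz (V₂ z.1))).trans ?_
  ring

/-- Functions on `T*M` which agree over an open set have the same differentials there. -/
theorem mfderiv_cot_congr {h h' : CotBundle 𝕜 E M → 𝕜} (hW : IsOpen W)
    (hh : ∀ z : CotBundle 𝕜 E M, z.1 ∈ W → h z = h' z) {z : CotBundle 𝕜 E M} (hz : z.1 ∈ W) :
    mfderiv (cotModel 𝕜 E) 𝓘(𝕜, 𝕜) h z = mfderiv (cotModel 𝕜 E) 𝓘(𝕜, 𝕜) h' z :=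
  Filter.EventuallyEq.mfderiv_eq
    (Filter.eventuallyEq_of_mem ((isOpen_proj_preimage hW).mem_nhds hz) hh)

theorem dcot_congr {h h' : CotBundle 𝕜 E M → 𝕜} (hW : IsOpen W)
    (hh : ∀ z : CotBundle 𝕜 E M, z.1 ∈ W → h z = h' z) {z : CotBundle 𝕜 E M} (hz : z.1 ∈ W)
    (X : CotTangent 𝕜 z) : dcot 𝕜 h z X = dcot 𝕜 h' z X :=
  congrArg (fun T : CotTangent 𝕜 z →L[𝕜] 𝕜 => T X) (mfderiv_cot_congr hW hh hz)

theorem isHamAt_congr {h h' : CotBundle 𝕜 E M → 𝕜} (hW : IsOpen W)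
    (hh : ∀ z : CotBundle 𝕜 E M, z.1 ∈ W → h z = h' z) {z : CotBundle 𝕜 E M} (hz : z.1 ∈ W)
    (X : CotTangent 𝕜 z) : IsHamAt 𝕜 h z X ↔ IsHamAt 𝕜 h' z X :=
  forall_congr' fun Y => by rw [dcot_congr hW hh hz]

theorem poisson_congr {h h' k k' : CotBundle 𝕜 E M → 𝕜} (hW : IsOpen W)
    (hh : ∀ z : CotBundle 𝕜 E M, z.1 ∈ W → h z = h' z)
    (hk : ∀ z : CotBundle 𝕜 E M, z.1 ∈ W → k z = k' z) {z : CotBundle 𝕜 E M} (hz : z.1 ∈ W) :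
    poisson 𝕜 h k z = poisson 𝕜 h' k' z := by
  rw [poisson, poisson, dcot_congr hW hh hz, dcot_congr hW hk hz, dbase, dbase, dbase, dbase,
    mfderiv_cot_congr hW hh hz, mfderiv_cot_congr hW hk hz]
  rfl

/-- A smooth one-form `θ`, regarded as a map `M → T*M`, in canonical coordinates: its derivative
along `v` is `(v, q)`, where `q` is the derivative of the coefficients of `θ`. -/
theorem mfderiv_form {θ : Π x : M, Cot 𝕜 E x} (hW : IsOpen W) (hθ : FormOn 𝕜 E θ W) {x : M}
    (hx : x ∈ W) (v : TangentSpace 𝓘(𝕜, E) x) :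
    ∃ q : Cot 𝕜 E x,
      mfderiv 𝓘(𝕜, E) (cotModel 𝕜 E) (fun y => (⟨y, θ y⟩ : CotBundle 𝕜 E M)) x v
        = ofComps 𝕜 ⟨x, θ x⟩ v q ∧
      ∀ (O : Set M) (Y : Π x : M, TangentSpace 𝓘(𝕜, E) x), IsOpen O → x ∈ O → FieldOn 𝕜 E Y O →
        along 𝕜 E (fun y => θ y (Y y)) x v
          = q (Y x) + along 𝕜 E (fun y => dfun 𝕜 E (linCoord 𝕜 E x (θ x)) y (Y y)) x v := by
  have hθx : MDifferentiableAt 𝓘(𝕜, E) (cotModel 𝕜 E)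
      (fun y => (⟨y, θ y⟩ : CotBundle 𝕜 E M)) x :=
    ((hθ x hx).contMDiffAt (hW.mem_nhds hx)).mdifferentiableAt (by simp)
  set X : CotTangent 𝕜 (⟨x, θ x⟩ : CotBundle 𝕜 E M) :=
    mfderiv 𝓘(𝕜, E) (cotModel 𝕜 E) (fun y => (⟨y, θ y⟩ : CotBundle 𝕜 E M)) x v with hX
  have h1 : (comps 𝕜 X).1 = v := by
    rw [← mfderiv_cot_proj]
    have h := mfderiv_comp x (mdifferentiableAt_cot_proj ⟨x, θ x⟩) hθx
    have h' := congrArg (fun T : E →L[𝕜] E => T v) h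
    refine h'.symm.trans ?_
    exact congrArg (fun T : E →L[𝕜] E => T v) (mfderiv_id (I := 𝓘(𝕜, E)) (x := x))
  refine ⟨(comps 𝕜 X).2, Prod.ext h1 rfl, fun O Y hO hxO hY => ?_⟩
  -- The function `θ(Y)` is the linear Hamiltonian `⟨Y|ξ⟩` restricted to the section `θ`. The chain
  -- rule splits its derivative into the vertical part `q(Y)` and the part along the base at
  -- constant momentum.
  have hz : FunOn 𝕜 E (fun _ : M => (0 : 𝕜)) O := contMDiffOn_const
  have hm := affHam_mdifferentiableAt (z := ⟨x, θ x⟩) hO hY hz hxO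
  have h2 := congrArg (fun T : E →L[𝕜] 𝕜 => T v) (mfderiv_comp x hm hθx)
  have h3 := dcot_affHam_fibre (E := E) hO hY hz (z := ⟨x, θ x⟩) hxO (comps 𝕜 X).2
  have h4 := dbase_affHam (E := E) hO hY hz (z := ⟨x, θ x⟩) hxO v
  have h5 : along 𝕜 E (fun _ : M => (0 : 𝕜)) x v = 0 := by
    exact congrArg (fun T : E →L[𝕜] 𝕜 => T v) (dfun_zero (𝕜 := 𝕜) (E := E) x)
  rw [h5, add_zero] at h4
  rw [← h3, ← h4]
  have e : X = ofComps (E := E) 𝕜 _ v 0 + ofComps (E := E) 𝕜 _ 0 (comps 𝕜 X).2 :=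
    Prod.ext (h1.trans (add_zero _).symm) (zero_add _).symm
  have h6 : along 𝕜 E (fun y => θ y (Y y)) x v
      = dcot 𝕜 (affHam Y fun _ => 0) ⟨x, θ x⟩ X := by
    refine Eq.trans ?_ h2
    refine along_congr isOpen_univ (fun y _ => ?_) (mem_univ x) v
    exact (add_zero _).symm
  rw [h6, add_comm]
  conv_lhs => rw [e]
  exact map_add (mfderiv (cotModel 𝕜 E) 𝓘(𝕜, 𝕜) (affHam Y fun _ => 0) ⟨x, θ x⟩ :
    CotTangent 𝕜 _ →L[𝕜] 𝕜) _ _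

end AffineHamiltonian

/-! ### Points of an affine space in different coordinates -/

namespace AffineSpace

variable {𝕜 : Type*} [RCLike 𝕜] {E : Type*} [NormedAddCommGroup E] [NormedSpace 𝕜 E]
  {M : Type*} [TopologicalSpace M] [ChartedSpace E M] [IsManifold 𝓘(𝕜, E) ∞ M]
  {ι : Type*} {U : ι → Opens M} (R : AffineSpace 𝕜 E U)

theorem point_coord {α : ι} {x : M} (hx : x ∈ U α) (r : R.Fiber x) :
    R.point α hx (r.coord ⟨α, hx⟩) = r :=
  Fiber.ext (funext fun β => (r.compat β ⟨α, hx⟩).symm)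

theorem point_eq_point {α β : ι} {x : M} (hα : x ∈ U α) (hβ : x ∈ U β) (ξ : Cot 𝕜 E x) :
    R.point β hβ ξ = R.point α hα (ξ + R.trans α β x) := by
  refine Fiber.ext (funext fun γ => ?_)
  change ξ + R.trans γ.1 β x = ξ + R.trans α β x + R.trans γ.1 α x
  rw [← R.cocycle γ.1 α β x ⟨⟨γ.2, hα⟩, hβ⟩]
  abel

end AffineSpace

/-! ### Normal form of Hamiltonian lifts -/

section Lifts

variable {𝕜 : Type*} [RCLike 𝕜] {E : Type*} [NormedAddCommGroup E] [NormedSpace 𝕜 E]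
  {M : Type*} [TopologicalSpace M] [ChartedSpace E M] [IsManifold 𝓘(𝕜, E) ∞ M]
  {F : Type*} [NormedAddCommGroup F] [NormedSpace 𝕜 F]
  {A : M → Type*} [∀ x, AddCommGroup (A x)] [∀ x, Module 𝕜 (A x)] [∀ x, TopologicalSpace (A x)]
  [TopologicalSpace (TotalSpace F A)] [FiberBundle F A] [VectorBundle 𝕜 F A]
  {ι : Type*} {U : ι → Opens M}

variable (𝕜 E F) in
-- A section with constant components in a local trivialization does this. Global sections may be
-- scarce in the holomorphic case, which is why the conditions on a lift are tested on local ones.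
theorem exists_secOn_eq [ContMDiffVectorBundle ∞ F A 𝓘(𝕜, E)] (x : M) (a : A x) :
    ∃ (W : Set M) (σ : Π x : M, A x), IsOpen W ∧ x ∈ W ∧ SecOn 𝕜 E F σ W ∧ σ x = a := by
  set e := trivializationAt F A x with he
  have hx : x ∈ e.baseSet := FiberBundle.mem_baseSet_trivializationAt' x
  refine ⟨e.baseSet, fun y => e.symm y (e ⟨x, a⟩).2, e.open_baseSet, hx, ?_, ?_⟩
  · refine (e.contMDiffOn_section_baseSet_iff (n := ∞) (IB := 𝓘(𝕜, E))).2 ?_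
    refine contMDiffOn_const (c := (e ⟨x, a⟩).2).congr fun y hy => ?_
    rw [e.apply_mk_symm hy]
  · exact e.symm_apply_apply_mk hx a

theorem LieAlgebroid.anchor_fieldOn (L : LieAlgebroid 𝕜 E F A) {ε : Π x : M, A x} {W : Set M}
    (hε : SecOn 𝕜 E F ε W) : FieldOn 𝕜 E (fun y => L.anchor y (ε y)) W :=
  ContMDiffOn.clm_bundle_apply (F₁ := F) L.anchor_smooth.contMDiffOn hε

/-- In trivializations `ξ ∘ δ` is the product of the coordinate expressions of `ξ` and `δ`: the
trivialization of `TM` and its inverse cancel in between. -/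
theorem contMDiffOn_comp_anchor (L : LieAlgebroid 𝕜 E F A) {c : Π x : M, Dual 𝕜 A x} {W : Set M}
    (hW : IsOpen W) (hc : DualOn 𝕜 E F c W) :
    ContMDiffOn (cotModel 𝕜 E) (𝓘(𝕜, E).prod 𝓘(𝕜, F →L[𝕜] 𝕜)) ∞
      (fun z : CotBundle 𝕜 E M => TotalSpace.mk' (F →L[𝕜] 𝕜) (E := fun x : M => Dual 𝕜 A x) z.1
        ((z.2 : Cot 𝕜 E z.1).comp (L.anchor z.1) + c z.1)) {z | z.1 ∈ W} := by
  intro z hz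
  refine ContMDiffAt.contMDiffWithinAt ?_
  have h1 := ((contMDiffAt_hom_bundle (n := ∞) (IM := cotModel 𝕜 E) (IB := 𝓘(𝕜, E))
    (fun w : CotBundle 𝕜 E M => w) (x₀ := z)).1 contMDiffAt_id).2
  have h2 := ((contMDiffAt_hom_bundle (n := ∞) _ (x₀ := z.1)).1 (L.anchor_smooth z.1)).2
  have h3 := ((contMDiffAt_hom_bundle (n := ∞) _ (x₀ := z.1)).1
    ((hc z.1 hz).contMDiffAt (hW.mem_nhds hz))).2
  have hp := contMDiff_cot_proj (𝕜 := 𝕜) (E := E) (M := M) z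
  refine (contMDiffAt_hom_bundle _).2 ⟨hp, ?_⟩
  have h4 := (h1.clm_comp (h2.comp z hp)).add (h3.comp z hp)
  refine h4.congr_of_eventuallyEq ?_
  have hb := mem_chart_source E z.1
  filter_upwards [(isOpen_proj_preimage (chartAt E z.1).open_source).mem_nhds hb] with w hw
  refine (dual_inCoordinates z.1 w.1 _).trans ?_
  refine ContinuousLinearMap.ext fun v => ?_
  have e1 := congrArg (fun T : E →L[𝕜] 𝕜 =>
      T (ContinuousLinearMap.inCoordinates F A E (TangentSpace 𝓘(𝕜, E)) z.1 w.1 z.1 w.1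
        (L.anchor w.1) v)) (dual_inCoordinates (𝕜 := 𝕜) (F := E) z.1 w.1 w.2)
  have e2 := congrArg (fun T : F →L[𝕜] 𝕜 => T v) (dual_inCoordinates (F := F) z.1 w.1 (c w.1))
  refine Eq.trans ?_ (congrArg₂ (· + ·) e1.symm e2.symm)
  have e3 := (trivializationAt E (TangentSpace 𝓘(𝕜, E)) z.1).symmL_continuousLinearMapAt (R := 𝕜) hw
    (L.anchor w.1 ((trivializationAt F A z.1).symmL 𝕜 w.1 v))
  exact congrArg (fun u => (w.2 : Cot 𝕜 E w.1) u + c w.1 ((trivializationAt F A z.1).symmL 𝕜 w.1 v))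
    e3.symm

theorem HasForm.loc_eq {R : AffineSpace 𝕜 E U} {μ : Moment R A} {L : LieAlgebroid 𝕜 E F A}
    {c : ι → Π x : M, Dual 𝕜 A x} (h : HasForm L μ c) {α : ι} {z : CotBundle 𝕜 E M}
    (hz : z.1 ∈ U α) :
    Moment.loc μ α z = (z.2 : Cot 𝕜 E z.1).comp (L.anchor z.1) + c α z.1 := by
  rw [Moment.loc, dif_pos hz]
  exact ContinuousLinearMap.ext fun a => h α z.1 hz z.2 a

theorem HasForm.ham_eq {R : AffineSpace 𝕜 E U} {μ : Moment R A} {L : LieAlgebroid 𝕜 E F A}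
    {c : ι → Π x : M, Dual 𝕜 A x} (h : HasForm L μ c) (ε : Π x : M, A x) {α : ι}
    {z : CotBundle 𝕜 E M} (hz : z.1 ∈ U α) :
    Moment.ham μ ε α z = affHam (fun y => L.anchor y (ε y)) (fun y => c α y (ε y)) z := by
  rw [Moment.ham, h.loc_eq hz]
  rfl

/-- Hamiltonians of the form `⟨δ_ε|ξ_α⟩ + c_α(x; ε)` with a cocycle `c_α` define a lift. -/
theorem HasForm.isHamiltonianLift [CompleteSpace E] {R : AffineSpace 𝕜 E U} {μ : Moment R A}
    {L : LieAlgebroid 𝕜 E F A} {c : ι → Π x : M, Dual 𝕜 A x} (h : HasForm L μ c)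
    (hc : ∀ α, DualOn 𝕜 E F (c α) (U α)) (hcl : ∀ α, L.CocycleOn (c α) (U α)) :
    IsHamiltonianLift L μ where
  smooth α := (contMDiffOn_comp_anchor L (U α).isOpen (hc α)).congr fun z hz => by
    rw [h.loc_eq hz]
  covers W ε hW hε α z hzW hzα := by
    have hO := hW.inter (U α).isOpen
    have hε' : SecOn 𝕜 E F ε (W ∩ U α) := hε.mono inter_subset_left
    refine ⟨_, (isHamAt_congr (U α).isOpen (fun w hw => h.ham_eq ε hw) hzα _).2
      (affHam_isHamAt hO (L.anchor_fieldOn hε')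
        (DualOn.pair ((hc α).mono inter_subset_right) hε') ⟨hzW, hzα⟩), ?_⟩
    exact mfderiv_cot_proj _ _
  bracket W ε₁ ε₂ hW hε₁ hε₂ α z hzW hzα := by
    have hO := hW.inter (U α).isOpen
    have hs : ∀ {ε : Π x : M, A x}, SecOn 𝕜 E F ε W → SecOn 𝕜 E F ε (W ∩ U α) :=
      fun hε => hε.mono inter_subset_left
    have hp : ∀ {ε : Π x : M, A x}, SecOn 𝕜 E F ε W →
        FunOn 𝕜 E (fun y => c α y (ε y)) (W ∩ U α) :=
      fun hε => DualOn.pair ((hc α).mono inter_subset_right) (hs hε)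
    rw [poisson_congr (U α).isOpen (fun w hw => h.ham_eq ε₁ hw) (fun w hw => h.ham_eq ε₂ hw) hzα,
      poisson_affHam hO (L.anchor_fieldOn (hs hε₁)) (L.anchor_fieldOn (hs hε₂)) (hp hε₁) (hp hε₂)
        ⟨hzW, hzα⟩, h.ham_eq _ hzα, affHam,
      L.anchor_bracket W hW ε₁ ε₂ hε₁ hε₂ z.1 hzW]
    -- The terms with `ξ` already agree because the anchor respects brackets. What is left is the
    -- first cocycle equation.
    have := hcl α _ hO inter_subset_right ε₁ ε₂ (hs hε₁) (hs hε₂) z.1 ⟨hzW, hzα⟩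
    exact congrArg _ (sub_eq_zero.1 this)

theorem IsHamiltonianLift.ham_contMDiffOn {R : AffineSpace 𝕜 E U} {μ : Moment R A}
    {L : LieAlgebroid 𝕜 E F A} (h : IsHamiltonianLift L μ) {W : Set M} {ε : Π x : M, A x}
    (hε : SecOn 𝕜 E F ε W) (α : ι) :
    ContMDiffOn (cotModel 𝕜 E) 𝓘(𝕜, 𝕜) ∞ (Moment.ham μ ε α) {z | z.1 ∈ W ∩ U α} := by
  intro z hz
  have h1 : ContMDiffWithinAt (cotModel 𝕜 E) (𝓘(𝕜, E).prod 𝓘(𝕜, 𝕜)) ∞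
      (fun w : CotBundle 𝕜 E M ↦ TotalSpace.mk' 𝕜 (E := fun _ : M => 𝕜) w.1
        (Moment.loc μ α w (ε w.1))) {z | z.1 ∈ W ∩ U α} z :=
    ContMDiffWithinAt.clm_bundle_apply (F₁ := F) ((h.smooth α z hz.2).mono fun _ h => h.2)
      (((hε.mono inter_subset_left).comp contMDiff_cot_proj.contMDiffOn fun _ h => h) z hz)
  rw [contMDiffWithinAt_totalSpace] at h1
  exact h1.2

/-- That the Hamiltonian field covers `δ_ε` prescribes the derivative of `h_ε` along the fibre at
every point of it. So on the line `tξ` the function `h_ε - t⟨δ_ε|ξ⟩` has derivative zero and equals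
its value at zero momentum, which serves as `c_α(ε)`. -/
theorem IsHamiltonianLift.hasForm [ContMDiffVectorBundle ∞ F A 𝓘(𝕜, E)]
    {R : AffineSpace 𝕜 E U} {μ : Moment R A}
    {L : LieAlgebroid 𝕜 E F A} (h : IsHamiltonianLift L μ) :
    HasForm L μ fun α x => Moment.loc μ α ⟨x, 0⟩ := by
  intro α x hx ξ a
  obtain ⟨W, σ, hW, hxW, hσ, rfl⟩ := exists_secOn_eq 𝕜 E F x a
  have hm : ∀ η : Cot 𝕜 E x,
      MDifferentiableAt (cotModel 𝕜 E) 𝓘(𝕜, 𝕜) (Moment.ham μ σ α) ⟨x, η⟩ := fun η =>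
    ((h.ham_contMDiffOn hσ α ⟨x, η⟩ ⟨hxW, hx⟩).contMDiffAt
      ((isOpen_proj_preimage (hW.inter (U α).isOpen)).mem_nhds ⟨hxW, hx⟩)).mdifferentiableAt
      (by simp)
  have hd : ∀ η : Cot 𝕜 E x, dcot 𝕜 (Moment.ham μ σ α) ⟨x, η⟩ (ofComps 𝕜 ⟨x, η⟩ 0 ξ)
      = ξ (L.anchor x (σ x)) := by
    intro η
    obtain ⟨X, hX, hX'⟩ := h.covers W σ hW hσ α ⟨x, η⟩ hxW hx
    rw [← hX, ← hX', mfderiv_cot_proj]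
    change ξ (comps 𝕜 X).1 - (comps 𝕜 X).2 0 = _
    rw [map_zero, sub_zero]
  have hder : ∀ t : 𝕜, HasDerivAt (fun t : 𝕜 => Moment.ham μ σ α ⟨x, t • ξ⟩)
      (ξ (L.anchor x (σ x))) t := by
    intro t
    have h1 := hasDerivAt_fibre (hm (t • ξ)) ξ
    rw [hd] at h1
    -- `hasDerivAt_fibre` differentiates at parameter zero only, so the line is recentred at `t`.
    have h2 : HasDerivAt (fun s : 𝕜 => s - t) 1 t := (hasDerivAt_id t).sub_const t
    have h3 := HasDerivAt.scomp (h := fun s : 𝕜 => s - t) t (by rwa [sub_self]) h2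
    rw [one_smul] at h3
    refine h3.congr_of_eventuallyEq (Filter.Eventually.of_forall fun s => ?_)
    have e : s • ξ = t • ξ + (s - t) • ξ := ContinuousLinearMap.ext fun v => by
      change s * ξ v = t * ξ v + (s - t) * ξ v
      ring
    exact congrArg (fun η : Cot 𝕜 E x => Moment.ham μ σ α ⟨x, η⟩) e
  have hder' : ∀ t : 𝕜, HasDerivAt
      (fun t : 𝕜 => Moment.ham μ σ α ⟨x, t • ξ⟩ - t * ξ (L.anchor x (σ x))) 0 t := fun t => by
    simpa using! (hder t).sub ((hasDerivAt_id t).mul_const (ξ (L.anchor x (σ x))))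
  have hcst := is_const_of_deriv_eq_zero (fun t => (hder' t).differentiableAt)
    (fun t => (hder' t).deriv) 1 0
  have e1 : ∀ η : Cot 𝕜 E x, Moment.ham μ σ α ⟨x, η⟩ = μ x (R.point α hx η) (σ x) := fun η => by
    rw [Moment.ham, Moment.loc, dif_pos hx]
  have e2 : (0 : 𝕜) • ξ = 0 := ContinuousLinearMap.ext fun v => zero_mul (ξ v)
  rw [e2] at hcst
  simp only [one_smul, one_mul, zero_mul, sub_zero] at hcst
  rw [e1, sub_eq_iff_eq_add] at hcst
  rw [hcst, add_comm]
  rfl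

/-- Setting `ξ_α = 0` recovers `c_α`. Hence the normal form is unique over `U α`, and `c_α` inherits
smoothness from the moment map. -/
theorem HasForm.eq_loc_zero {R : AffineSpace 𝕜 E U} {μ : Moment R A} {L : LieAlgebroid 𝕜 E F A}
    {c : ι → Π x : M, Dual 𝕜 A x} (h : HasForm L μ c) {α : ι} {x : M} (hx : x ∈ U α) :
    c α x = Moment.loc μ α ⟨x, 0⟩ := by
  rw [h.loc_eq (z := ⟨x, 0⟩) hx]
  exact ContinuousLinearMap.ext fun a => (zero_add (c α x a)).symm

theorem DualOn.congr {c c' : Π x : M, Dual 𝕜 A x} {W : Set M} (h : DualOn 𝕜 E F c W)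
    (hc : ∀ x ∈ W, c' x = c x) : DualOn 𝕜 E F c' W :=
  ContMDiffOn.congr h fun x hx => by rw [hc x hx]

theorem LieAlgebroid.CocycleOn.congr {L : LieAlgebroid 𝕜 E F A} {c c' : Π x : M, Dual 𝕜 A x}
    {O : Set M} (h : L.CocycleOn c O) (hc : ∀ x ∈ O, c' x = c x) : L.CocycleOn c' O := by
  intro W hW hWO σ τ hσ hτ x hx
  have e : ∀ υ υ' : Π x : M, A x,
      L.act υ (fun y => c' y (υ' y)) x = L.act υ (fun y => c y (υ' y)) x := fun υ υ' =>
    along_congr hW (fun y hy => by rw [hc y (hWO hy)]) hx _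
  rw [e, e, hc x (hWO hx)]
  exact h W hW hWO σ τ hσ hτ x hx

/-- The properties of the `c_α` in the Hamiltonians `⟨δ_ε|ξ_α⟩ + c_α(x; ε)` of a lift. -/
theorem IsHamiltonianLift.form_spec [CompleteSpace E] {R : AffineSpace 𝕜 E U} {μ : Moment R A}
    {L : LieAlgebroid 𝕜 E F A} (h : IsHamiltonianLift L μ) {c : ι → Π x : M, Dual 𝕜 A x}
    (hc : HasForm L μ c) :
    (∀ α, DualOn 𝕜 E F (c α) (U α)) ∧ (∀ α, L.CocycleOn (c α) (U α)) ∧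
      ∀ α β, ∀ x ∈ (U α ∩ U β : Set M),
        c β x - c α x = (R.trans α β x).comp (L.anchor x) := by
  have hs : ∀ α, DualOn 𝕜 E F (c α) (U α) := fun α =>
    DualOn.congr (c := fun x => Moment.loc μ α ⟨x, 0⟩)
      ((h.smooth α).comp (contMDiff_zeroSection 𝕜 (fun x : M => Cot 𝕜 E x)).contMDiffOn
        fun _ hx => hx) fun x hx => hc.eq_loc_zero hx
  refine ⟨hs, fun α W hW hWU σ τ hσ hτ x hx => ?_, fun α β x hx => ?_⟩
  · have hp : ∀ {ε : Π x : M, A x}, SecOn 𝕜 E F ε W → FunOn 𝕜 E (fun y => c α y (ε y)) W :=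
      fun hε => DualOn.pair ((hs α).mono hWU) hε
    -- At zero momentum only the terms free of `ξ` survive in the bracket formula, and they form the
    -- cocycle equation.
    have hb := h.bracket W σ τ hW hσ hτ α ⟨x, 0⟩ hx (hWU hx)
    rw [poisson_congr (z := ⟨x, 0⟩) (U α).isOpen (fun w hw => hc.ham_eq σ hw)
      (fun w hw => hc.ham_eq τ hw) (hWU hx),
      poisson_affHam hW (L.anchor_fieldOn hσ) (L.anchor_fieldOn hτ) (hp hσ) (hp hτ) hx,
      hc.ham_eq (z := ⟨x, 0⟩) _ (hWU hx)] at hb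
    exact sub_eq_zero.2 (((zero_add _).symm.trans hb).trans (zero_add _))
  · refine ContinuousLinearMap.ext fun a => ?_
    -- The point with `ξ_β = 0` has `ξ_α = ς_αβ`; both normal forms are evaluated there.
    have h1 := hc β x hx.2 0 a
    rw [R.point_eq_point hx.1 hx.2, hc α x hx.1] at h1
    have e : (0 + R.trans α β x : Cot 𝕜 E x) = R.trans α β x := zero_add _
    rw [e] at h1
    change c β x a - c α x a = R.trans α β x (L.anchor x a)
    have h2 : (0 : Cot 𝕜 E x) (L.anchor x a) = 0 := rfl
    rw [h2] at h1
    linear_combination -h1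

/-- Hamiltonian lifts in coordinates. -/
theorem isHamiltonianLift_iff [CompleteSpace E] [ContMDiffVectorBundle ∞ F A 𝓘(𝕜, E)]
    {R : AffineSpace 𝕜 E U} {μ : Moment R A} {L : LieAlgebroid 𝕜 E F A} :
    IsHamiltonianLift L μ ↔
      ∃ c : ι → Π x : M, Dual 𝕜 A x,
        (∀ α, DualOn 𝕜 E F (c α) (U α)) ∧ (∀ α, L.CocycleOn (c α) (U α)) ∧
        (∀ α β, ∀ x ∈ (U α ∩ U β : Set M),
          c β x - c α x = (R.trans α β x).comp (L.anchor x)) ∧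
        HasForm L μ c := by
  refine ⟨fun h => ⟨_, (h.form_spec h.hasForm).1, (h.form_spec h.hasForm).2.1,
    (h.form_spec h.hasForm).2.2, h.hasForm⟩, ?_⟩
  rintro ⟨c, h1, h2, -, h4⟩
  exact h4.isHamiltonianLift h1 h2

end Lifts

/-! ### The Lie derivative of sections -/

section ActionOnSections

variable {𝕜 : Type*} [RCLike 𝕜] {E : Type*} [NormedAddCommGroup E] [NormedSpace 𝕜 E]
  [CompleteSpace E]
  {M : Type*} [TopologicalSpace M] [ChartedSpace E M] [IsManifold 𝓘(𝕜, E) ∞ M]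

/-- The covector `ℒ_V θ + dg` at `x`: at the points of the section `θ`, the Hamiltonian vector field
of `⟨V|ξ⟩ + g` is the derivative of the section along `V` minus this covector. -/
theorem exists_lieDerivative {θ : Π x : M, Cot 𝕜 E x} {V : Π x : M, TangentSpace 𝓘(𝕜, E) x}
    {g : M → 𝕜} {W : Set M} (hW : IsOpen W) (hθ : FormOn 𝕜 E θ W) (hV : FieldOn 𝕜 E V W)
    (hg : FunOn 𝕜 E g W) {x : M} (hx : x ∈ W) :
    ∃ ρ : Cot 𝕜 E x,
      (∀ (O : Set M) (Y : Π x : M, TangentSpace 𝓘(𝕜, E) x), IsOpen O → x ∈ O →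
        FieldOn 𝕜 E Y O →
          ρ (Y x) = along 𝕜 E (fun y => θ y (Y y)) x (V x)
            - θ x (mlieBracket 𝓘(𝕜, E) V Y x) + along 𝕜 E g x (Y x)) ∧
      IsHamAt 𝕜 (affHam V g) ⟨x, θ x⟩
        (mfderiv 𝓘(𝕜, E) (cotModel 𝕜 E) (fun y => (⟨y, θ y⟩ : CotBundle 𝕜 E M)) x (V x)
          - ofComps 𝕜 ⟨x, θ x⟩ 0 ρ) := by
  obtain ⟨q, hq, hqY⟩ := mfderiv_form hW hθ hx (V x)
  set b : Cot 𝕜 E x := dbase (E := E) 𝕜 (affHam V g) ⟨x, θ x⟩ with hb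
  -- In canonical coordinates the section moves along `V` with velocity `(V, q)`, while the
  -- Hamiltonian field is `(V, -b)`. They differ by the vertical vector `q + b`.
  refine ⟨q + b, fun O Y hO hxO hY => ?_, ?_⟩
  · have hc := (chartAt E x).open_source
    -- The formulas for `q(Y)` and `b(Y)` contain terms depending on the chart at `x`. By `d(df) =
    -- 0` for `f = linCoord`, these combine into `θ([V, Y])`.
    have hbr := mlieBracket_dfun ((hW.inter hO).inter hc)
      ((linCoord_funOn (E := E) x (θ x)).mono inter_subset_right)
      (hV.mono fun _ h => h.1.1) (hY.mono fun _ h => h.1.2) ⟨⟨hx, hxO⟩, mem_chart_source E x⟩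
    have e : dfun 𝕜 E (linCoord 𝕜 E x (θ x)) x = θ x := dfun_linCoord_self x (θ x)
    rw [e] at hbr
    have hbY : b (Y x) = _ := dbase_affHam (E := E) hW hV hg (z := ⟨x, θ x⟩) hx (Y x)
    rw [hbr, hqY O Y hO hxO hY]
    refine (congrArg (q (Y x) + ·) hbY).trans ?_
    ring
  · rw [hq]
    have e : ofComps 𝕜 ⟨x, θ x⟩ (V x) q - ofComps 𝕜 ⟨x, θ x⟩ 0 (q + b)
        = ofComps 𝕜 ⟨x, θ x⟩ (V x) (-b) :=
      Prod.ext (sub_zero _) (by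
        change q - (q + b) = -b
        abel)
    rw [e]
    exact affHam_isHamAt hW hV hg (z := ⟨x, θ x⟩) hx

variable {F : Type*} [NormedAddCommGroup F] [NormedSpace 𝕜 F]
  {A : M → Type*} [∀ x, AddCommGroup (A x)] [∀ x, Module 𝕜 (A x)] [∀ x, TopologicalSpace (A x)]
  [TopologicalSpace (TotalSpace F A)] [FiberBundle F A] [VectorBundle 𝕜 F A]
  {ι : Type*} {U : ι → Opens M}

/-- The action of the algebroid on the sections of `R`. -/
theorem IsHamiltonianLift.exists_action_on_section {R : AffineSpace 𝕜 E U} {μ : Moment R A}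
    {L : LieAlgebroid 𝕜 E F A} (h : IsHamiltonianLift L μ) {c : ι → Π x : M, Dual 𝕜 A x}
    (hc : HasForm L μ c) {W : Set M} {ε : Π x : M, A x} {s : Π x : M, R.Fiber x} (hW : IsOpen W)
    (hε : SecOn 𝕜 E F ε W) (hs : R.SectionOn s W) {x : M} (hx : x ∈ W) :
    ∃ ρ : Cot 𝕜 E x, ∀ α, x ∈ U α →
      (∀ (O : Set M) (Y : Π x : M, TangentSpace 𝓘(𝕜, E) x), IsOpen O → x ∈ O → FieldOn 𝕜 E Y O →
        ρ (Y x) = L.act ε (fun y => R.localForm s α y (Y y)) x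
          - R.localForm s α x (mlieBracket 𝓘(𝕜, E) (fun y => L.anchor y (ε y)) Y x)
          + along 𝕜 E (fun y => c α y (ε y)) x (Y x)) ∧
      IsHamAt 𝕜 (Moment.ham μ ε α) ⟨x, R.localForm s α x⟩
        (mfderiv 𝓘(𝕜, E) (cotModel 𝕜 E)
            (fun y => (⟨y, R.localForm s α y⟩ : CotBundle 𝕜 E M)) x (L.anchor x (ε x))
          - ofComps 𝕜 ⟨x, R.localForm s α x⟩ 0 ρ) := by
  obtain ⟨hcs, -, hct⟩ := h.form_spec hc
  have hO : ∀ α, IsOpen (W ∩ U α) := fun α => hW.inter (U α).isOpen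
  have hε' : ∀ α, SecOn 𝕜 E F ε (W ∩ U α) := fun α => hε.mono inter_subset_left
  have hg : ∀ α, FunOn 𝕜 E (fun y => c α y (ε y)) (W ∩ U α) := fun α =>
    DualOn.pair ((hcs α).mono inter_subset_right) (hε' α)
  have key := fun α (hα : x ∈ U α) =>
    exists_lieDerivative (hO α) (hs α) (L.anchor_fieldOn (hε' α)) (hg α) ⟨hx, hα⟩
  choose ρ hρ hρ' using key
  obtain ⟨⟨α₀, hα₀⟩⟩ := R.exists_index x
  -- Put `ς = ς_αα₀`. Since `ξ_α - ξ_α₀ = ς` and `c_α - c_α₀ = -ς(δ)`, the covectors differ by `ℒ_δ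
  -- ς - d(ς(δ))`. By Cartan's formula this is the contraction of `dς` with `δ`, which is zero.
  have hindep : ∀ α (hα : x ∈ U α), ρ α hα = ρ α₀ hα₀ := by
    intro α hα
    refine ContinuousLinearMap.ext fun v => ?_
    obtain ⟨O, Y, hOo, hxO, hY, rfl⟩ :=
      exists_secOn_eq 𝕜 E E (A := fun x : M => TangentSpace 𝓘(𝕜, E) x) x v
    rw [hρ α hα O Y hOo hxO hY, hρ α₀ hα₀ O Y hOo hxO hY]
    set N : Set M := W ∩ O ∩ (U α ∩ U α₀) with hN
    have hNo : IsOpen N := (hW.inter hOo).inter ((U α).isOpen.inter (U α₀).isOpen)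
    have hxN : x ∈ N := ⟨⟨hx, hxO⟩, hα, hα₀⟩
    have hYN : FieldOn 𝕜 E Y N := ContMDiffOn.mono hY fun _ h => h.1.2
    have hVN : FieldOn 𝕜 E (fun y => L.anchor y (ε y)) N :=
      L.anchor_fieldOn (hε.mono fun _ h => h.1.1)
    have hcl := R.closed α α₀ N hNo inter_subset_right _ Y hVN hYN x hxN
    have hf : ∀ y ∈ N, R.localForm s α y - R.localForm s α₀ y = R.trans α α₀ y := by
      intro y hy
      have h1 : y ∈ U α := hy.2.1
      have h2 : y ∈ U α₀ := hy.2.2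
      rw [AffineSpace.localForm, AffineSpace.localForm, dif_pos h1, dif_pos h2]
      exact sub_eq_of_eq_add' ((s y).compat ⟨α, h1⟩ ⟨α₀, h2⟩)
    have hfun : ∀ β, N ⊆ W ∩ U β → FunOn 𝕜 E (fun y => R.localForm s β y (Y y)) N := fun β hβ =>
      FormOn.pair ((hs β).mono hβ) hYN
    have hα' : N ⊆ W ∩ U α := fun _ h => ⟨h.1.1, h.2.1⟩
    have hα₀' : N ⊆ W ∩ U α₀ := fun _ h => ⟨h.1.1, h.2.2⟩
    have e1 := along_sub hNo (hfun α hα') (hfun α₀ hα₀') hxN (L.anchor x (ε x))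
    have e1' := along_congr (𝕜 := 𝕜) (E := E) hNo
      (f := fun y => R.localForm s α y (Y y) - R.localForm s α₀ y (Y y))
      (g := fun y => R.trans α α₀ y (Y y))
      (fun y hy => congrArg (fun T : Cot 𝕜 E y => T (Y y)) (hf y hy)) hxN (L.anchor x (ε x))
    have e2 := along_sub hNo ((hg α₀).mono hα₀') ((hg α).mono hα') hxN (Y x)
    have e2' := along_congr (𝕜 := 𝕜) (E := E) hNo
      (f := fun y => c α₀ y (ε y) - c α y (ε y))
      (g := fun y => R.trans α α₀ y (L.anchor y (ε y)))
      (fun y hy => congrArg (fun T : Dual 𝕜 A y => T (ε y)) (hct α α₀ y hy.2)) hxN (Y x)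
    have e3 := congrArg
      (fun T : Cot 𝕜 E x => T (mlieBracket 𝓘(𝕜, E) (fun y => L.anchor y (ε y)) Y x)) (hf x hxN)
    change R.localForm s α x _ - R.localForm s α₀ x _ = _ at e3
    rw [e1] at e1'
    rw [e2] at e2'
    rw [← e1', ← e2', ← e3] at hcl
    linear_combination hcl
  refine ⟨ρ α₀ hα₀, fun α hα => ⟨fun O Y hOo hxO hY => ?_, ?_⟩⟩
  · rw [← hindep α hα]
    exact hρ α hα O Y hOo hxO hY
  · rw [← hindep α hα]
    exact (isHamAt_congr (z := ⟨x, R.localForm s α x⟩) (U α).isOpen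
      (fun w hw => hc.ham_eq ε hw) hα _).2 (hρ' α hα)

end ActionOnSections

/-! ### Cocycles, twisted affine spaces and the lifts they define -/

section Classification

variable {𝕜 : Type*} [RCLike 𝕜] {E : Type*} [NormedAddCommGroup E] [NormedSpace 𝕜 E]
  {M : Type*} [TopologicalSpace M] [ChartedSpace E M] [IsManifold 𝓘(𝕜, E) ∞ M]
  {F : Type*} [NormedAddCommGroup F] [NormedSpace 𝕜 F]
  {A : M → Type*} [∀ x, AddCommGroup (A x)] [∀ x, Module 𝕜 (A x)] [∀ x, TopologicalSpace (A x)]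
  [TopologicalSpace (TotalSpace F A)] [FiberBundle F A] [VectorBundle 𝕜 F A]
  {ι : Type*} {U : ι → Opens M}

theorem DualOn.add {c c' : Π x : M, Dual 𝕜 A x} {W : Set M} (h : DualOn 𝕜 E F c W)
    (h' : DualOn 𝕜 E F c' W) : DualOn 𝕜 E F (fun x => c x + c' x) W :=
  ContMDiffOn.add_section h h'

theorem DualOn.sub {c c' : Π x : M, Dual 𝕜 A x} {W : Set M} (h : DualOn 𝕜 E F c W)
    (h' : DualOn 𝕜 E F c' W) : DualOn 𝕜 E F (fun x => c x - c' x) W :=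
  ContMDiffOn.sub_section h h'

theorem LieAlgebroid.CocycleOn.add {L : LieAlgebroid 𝕜 E F A} {c c' : Π x : M, Dual 𝕜 A x}
    {O : Set M} (h : L.CocycleOn c O) (h' : L.CocycleOn c' O) (hc : DualOn 𝕜 E F c O)
    (hc' : DualOn 𝕜 E F c' O) : L.CocycleOn (fun x => c x + c' x) O := by
  intro W hW hWO σ τ hσ hτ x hx
  have e : ∀ {υ υ' : Π x : M, A x}, SecOn 𝕜 E F υ' W →
      L.act υ (fun y => (c y + c' y) (υ' y)) x
        = L.act υ (fun y => c y (υ' y)) x + L.act υ (fun y => c' y (υ' y)) x := fun hυ =>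
    along_add hW (DualOn.pair (ContMDiffOn.mono hc hWO) hυ)
      (DualOn.pair (ContMDiffOn.mono hc' hWO) hυ) hx _
  rw [e hσ, e hτ]
  change _ - _ - (c x (L.bracket σ τ x) + c' x (L.bracket σ τ x)) = 0
  linear_combination h W hW hWO σ τ hσ hτ x hx + h' W hW hWO σ τ hσ hτ x hx

theorem LieAlgebroid.CocycleOn.sub {L : LieAlgebroid 𝕜 E F A} {c c' : Π x : M, Dual 𝕜 A x}
    {O : Set M} (h : L.CocycleOn c O) (h' : L.CocycleOn c' O) (hc : DualOn 𝕜 E F c O)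
    (hc' : DualOn 𝕜 E F c' O) : L.CocycleOn (fun x => c x - c' x) O := by
  intro W hW hWO σ τ hσ hτ x hx
  have e : ∀ {υ υ' : Π x : M, A x}, SecOn 𝕜 E F υ' W →
      L.act υ (fun y => (c y - c' y) (υ' y)) x
        = L.act υ (fun y => c y (υ' y)) x - L.act υ (fun y => c' y (υ' y)) x := fun hυ =>
    along_sub hW (DualOn.pair (ContMDiffOn.mono hc hWO) hυ)
      (DualOn.pair (ContMDiffOn.mono hc' hWO) hυ) hx _
  rw [e hσ, e hτ]
  change _ - _ - (c x (L.bracket σ τ x) - c' x (L.bracket σ τ x)) = 0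
  linear_combination h W hW hWO σ τ hσ hτ x hx - h' W hW hWO σ τ hσ hτ x hx

theorem LieAlgebroid.cls_eq_cls_iff (L : LieAlgebroid 𝕜 E F A) {z w : Cochain 𝕜 A ι}
    (hz : L.IsCocycle U z) (hw : L.IsCocycle U w) :
    L.cls U z hz = L.cls U w hw ↔
      ∃ f : ι → M → 𝕜, (∀ α, FunOn 𝕜 E (f α) (U α)) ∧
        (∀ α, ∀ x ∈ U α, w.1 α x - z.1 α x = L.d0 (f α) x) ∧
        ∀ α β, ∀ x ∈ (U α ∩ U β : Set M), w.2 α β x = z.2 α β x + (f β x - f α x) := by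
  refine QuotientAddGroup.eq.trans ?_
  refine exists_congr fun f => and_congr_right fun _ => and_congr ?_ ?_
  · refine forall₃_congr fun α x _ => ?_
    change -z.1 α x + w.1 α x = _ ↔ _
    rw [neg_add_eq_sub]
  · refine forall₄_congr fun α β x _ => ?_
    change -z.2 α β x + w.2 α β x = _ ↔ _
    rw [neg_add_eq_iff_eq_add]

variable (𝕜 E) in
/-- The cotangent bundle `T*M`, glued from the `T*(U α)` by the identity maps. -/
def AffineSpace.cotangent (hU : IsOpenCover U) : AffineSpace 𝕜 E U where
  cover := hU
  trans _ _ _ := 0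
  smooth α β := fun x _ =>
    (contMDiff_zeroSection 𝕜 (fun x : M => Cot 𝕜 E x) x).contMDiffWithinAt
  closed α β W hW hWU X Y hX hY x hx := by
    have e : ∀ v, along 𝕜 E (fun _ : M => (0 : 𝕜)) x v = 0 := fun v =>
      congrArg (fun T : E →L[𝕜] 𝕜 => T v) (dfun_zero (𝕜 := 𝕜) (E := E) x)
    change along 𝕜 E (fun _ : M => (0 : 𝕜)) x _ - along 𝕜 E (fun _ : M => (0 : 𝕜)) x _ - 0 = 0
    rw [e, e, sub_zero, sub_zero]
  cocycle α β γ x _ := add_zero 0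

theorem closedOn_dfun [CompleteSpace E] {f : M → 𝕜} {O : Set M} (hf : FunOn 𝕜 E f O) :
    ClosedOn 𝕜 E (dfun 𝕜 E f) O := by
  intro W hW hWO X Y hX hY x hx
  rw [mlieBracket_dfun hW (hf.mono hWO) hX hY hx, sub_self]

theorem ClosedOn.add {θ θ' : Π x : M, Cot 𝕜 E x} {O : Set M} (h : ClosedOn 𝕜 E θ O)
    (h' : ClosedOn 𝕜 E θ' O) (hθ : FormOn 𝕜 E θ O) (hθ' : FormOn 𝕜 E θ' O) :
    ClosedOn 𝕜 E (fun x => θ x + θ' x) O := by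
  intro W hW hWO X Y hX hY x hx
  have e : ∀ {Z : Π x : M, TangentSpace 𝓘(𝕜, E) x}, FieldOn 𝕜 E Z W → ∀ v,
      along 𝕜 E (fun y => (θ y + θ' y) (Z y)) x v
        = along 𝕜 E (fun y => θ y (Z y)) x v + along 𝕜 E (fun y => θ' y (Z y)) x v := fun hZ v =>
    along_add hW (FormOn.pair (ContMDiffOn.mono hθ hWO) hZ)
      (FormOn.pair (ContMDiffOn.mono hθ' hWO) hZ) hx v
  rw [e hX, e hY]
  change _ - _ - (θ x (mlieBracket 𝓘(𝕜, E) X Y x) + θ' x (mlieBracket 𝓘(𝕜, E) X Y x)) = 0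
  linear_combination h W hW hWO X Y hX hY x hx + h' W hW hWO X Y hX hY x hx

/-- The affine space with the transition forms `ς_αβ + dc_αβ`. -/
def AffineSpace.twist [CompleteSpace E] (R : AffineSpace 𝕜 E U) (p : ι → ι → M → 𝕜)
    (hp : ∀ α β, FunOn 𝕜 E (p α β) (U α ∩ U β))
    (hc : ∀ α β γ, ∀ x ∈ (U α ∩ U β ∩ U γ : Set M), p α γ x = p α β x + p β γ x) :
    AffineSpace 𝕜 E U where
  cover := R.cover
  trans α β x := R.trans α β x + dfun 𝕜 E (p α β) x
  smooth α β := ContMDiffOn.add_section (R.smooth α β)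
    ((hp α β).dfun_formOn ((U α).isOpen.inter (U β).isOpen))
  closed α β := (R.closed α β).add (closedOn_dfun (hp α β)) (R.smooth α β)
    ((hp α β).dfun_formOn ((U α).isOpen.inter (U β).isOpen))
  cocycle α β γ x hx := by
    have hO := ((U α).isOpen.inter (U β).isOpen).inter (U γ).isOpen
    have h1 : dfun 𝕜 E (p α γ) x = dfun 𝕜 E (p α β) x + dfun 𝕜 E (p β γ) x := by
      rw [dfun_congr hO (hc α β γ) hx]
      exact dfun_add hO ((hp α β).mono inter_subset_left)
        ((hp β γ).mono fun _ h => ⟨h.1.2, h.2⟩) hx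
    rw [h1, ← R.cocycle α β γ x hx]
    abel

/-- The moment map with the Hamiltonians `⟨δ_ε|ξ_α⟩ + c_α(x; ε)`. -/
def Moment.ofForm (R : AffineSpace 𝕜 E U) (L : LieAlgebroid 𝕜 E F A)
    (c : ι → Π x : M, Dual 𝕜 A x) : Moment R A := fun x r =>
  (r.coord (R.exists_index x).some).comp (L.anchor x) + c (R.exists_index x).some x

theorem Moment.ofForm_hasForm (R : AffineSpace 𝕜 E U) (L : LieAlgebroid 𝕜 E F A)
    (c : ι → Π x : M, Dual 𝕜 A x) (hc : ∀ α β, ∀ x ∈ (U α ∩ U β : Set M),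
      c β x - c α x = (R.trans α β x).comp (L.anchor x)) :
    HasForm L (Moment.ofForm R L c) c := by
  intro α x hx ξ a
  -- `Moment.ofForm` reads a point in an arbitrarily chosen coordinate. The gluing condition shows
  -- that every other coordinate gives the same value.
  have h := congrArg (fun T : Dual 𝕜 A x => T a)
    (hc (R.exists_index x).some α x ⟨(R.exists_index x).some.2, hx⟩)
  change c α x a - c (R.exists_index x).some x a
    = R.trans (R.exists_index x).some α x (L.anchor x a) at h
  change ξ (L.anchor x a) + R.trans (R.exists_index x).some α x (L.anchor x a)
    + c (R.exists_index x).some x a = _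
  linear_combination -h

/-- Every one-cocycle of the algebroid gives a Hamiltonian lift. -/
theorem LieAlgebroid.IsCocycle.exists_lift [CompleteSpace E] (hU : IsOpenCover U)
    {L : LieAlgebroid 𝕜 E F A} {z : Cochain 𝕜 A ι} (hz : L.IsCocycle U z) :
    ∃ (R : AffineSpace 𝕜 E U) (μ : Moment R A),
      (∀ α β, ∀ x ∈ (U α ∩ U β : Set M), R.trans α β x = dfun 𝕜 E (z.2 α β) x) ∧
      IsHamiltonianLift L μ ∧ HasForm L μ z.1 := by
  -- The affine space is `T*M` twisted by the Čech part of the cocycle; the mixed equation is then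
  -- the gluing condition.
  have ht : ∀ α β x, ((AffineSpace.cotangent 𝕜 E hU).twist z.2 hz.smooth_two hz.cech).trans α β x
      = dfun 𝕜 E (z.2 α β) x := fun α β x => zero_add _
  have hf := Moment.ofForm_hasForm
    ((AffineSpace.cotangent 𝕜 E hU).twist z.2 hz.smooth_two hz.cech) L z.1 fun α β x hx => by
      rw [ht, ← neg_add_eq_sub]
      exact (hz.mixed α β x hx).symm
  exact ⟨_, _, fun α β x _ => ht α β x, hf.isHamiltonianLift hz.smooth_one hz.closed, hf⟩

/-- The difference of two lifts is a one-cocycle. -/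
theorem isCocycle_sub [CompleteSpace E] {L : LieAlgebroid 𝕜 E F A} {R R' : AffineSpace 𝕜 E U}
    {μ : Moment R A} {μ' : Moment R' A} (h : IsHamiltonianLift L μ) (h' : IsHamiltonianLift L μ')
    {c c' : ι → Π x : M, Dual 𝕜 A x} (hc : HasForm L μ c) (hc' : HasForm L μ' c')
    {p : ι → ι → M → 𝕜} (hp : ∀ α β, FunOn 𝕜 E (p α β) (U α ∩ U β))
    (hpc : ∀ α β γ, ∀ x ∈ (U α ∩ U β ∩ U γ : Set M), p α γ x = p α β x + p β γ x)
    (ht : ∀ α β, ∀ x ∈ (U α ∩ U β : Set M),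
      R'.trans α β x = R.trans α β x + dfun 𝕜 E (p α β) x) :
    L.IsCocycle U (fun α x => c' α x - c α x, p) := by
  obtain ⟨h1, h2, h3⟩ := h.form_spec hc
  obtain ⟨h1', h2', h3'⟩ := h'.form_spec hc'
  refine ⟨fun α => (h1' α).sub (h1 α), hp, fun α => (h2' α).sub (h2 α) (h1' α) (h1 α),
    fun α β x hx => ?_, hpc⟩
  have e : L.d0 (p α β) x
      = (R'.trans α β x).comp (L.anchor x) - (R.trans α β x).comp (L.anchor x) := by
    rw [ht α β x hx]
    refine ContinuousLinearMap.ext fun a => ?_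
    exact (add_sub_cancel_left (R.trans α β x (L.anchor x a))
      (dfun 𝕜 E (p α β) x (L.anchor x a))).symm
  rw [e, ← h3 α β x hx, ← h3' α β x hx]
  change _ = -(c' α x - c α x) + (c' β x - c β x)
  abel

end Classification

/-! ### Classification of twisted lifts -/

section TwistedLifts

variable {𝕜 : Type*} [RCLike 𝕜] {E : Type*} [NormedAddCommGroup E] [NormedSpace 𝕜 E]
  {M : Type*} [TopologicalSpace M] [ChartedSpace E M] [IsManifold 𝓘(𝕜, E) ∞ M]
  {F : Type*} [NormedAddCommGroup F] [NormedSpace 𝕜 F]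
  {A : M → Type*} [∀ x, AddCommGroup (A x)] [∀ x, Module 𝕜 (A x)] [∀ x, TopologicalSpace (A x)]
  [TopologicalSpace (TotalSpace F A)] [FiberBundle F A] [VectorBundle 𝕜 F A]
  {ι : Type*} {U : ι → Opens M}

theorem HasForm.moment_apply {R : AffineSpace 𝕜 E U} {μ : Moment R A} {L : LieAlgebroid 𝕜 E F A}
    {c : ι → Π x : M, Dual 𝕜 A x} (h : HasForm L μ c) {α : ι} {x : M} (hx : x ∈ U α)
    (r : R.Fiber x) (a : A x) :
    μ x r a = r.coord ⟨α, hx⟩ (L.anchor x a) + c α x a := by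
  rw [← h α x hx, R.point_coord]

theorem dfun_eq_add_sub {O : Set M} (hO : IsOpen O) {p q f g : M → 𝕜} (hp : FunOn 𝕜 E p O)
    (hf : FunOn 𝕜 E f O) (hg : FunOn 𝕜 E g O) (h : ∀ x ∈ O, q x = p x + (g x - f x)) {x : M}
    (hx : x ∈ O) :
    dfun 𝕜 E q x = dfun 𝕜 E p x + (dfun 𝕜 E g x - dfun 𝕜 E f x) := by
  rw [dfun_congr hO h hx]
  exact (dfun_add hO hp (hg.sub hf) hx).trans (congrArg _ (dfun_sub hO hg hf hx))

/-- Substituting `ξ' = ξ - df` in `⟨δ|ξ'⟩ + c' = ⟨δ|ξ⟩ + c` leaves `c' - c = δf`, with no trace of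
`ξ`. -/
theorem TwistedLift.equivalent_iff {R : AffineSpace 𝕜 E U} {L : LieAlgebroid 𝕜 E F A}
    {T T' : TwistedLift R L} {c c' : ι → Π x : M, Dual 𝕜 A x} (hc : HasForm L T.moment c)
    (hc' : HasForm L T'.moment c') :
    T.Equivalent T' ↔
      ∃ f : ι → M → 𝕜, (∀ α, FunOn 𝕜 E (f α) (U α)) ∧
        (∀ α, ∀ x ∈ U α, c' α x - c α x = L.d0 (f α) x) ∧
        ∀ α β, ∀ x ∈ (U α ∩ U β : Set M), T'.pot α β x = T.pot α β x + (f β x - f α x) := by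
  refine exists_congr fun f => and_congr_right fun hf => ?_
  rw [and_comm]
  refine and_congr_left fun hp => ⟨fun h α x hx => ?_, fun h x r r' hr => ?_⟩
  · have ht : ∀ β γ : {α // x ∈ U α}, T'.space.trans β.1 γ.1 x
        = T.space.trans β.1 γ.1 x + (dfun 𝕜 E (f γ.1) x - dfun 𝕜 E (f β.1) x) := fun β γ => by
      rw [T.trans_eq _ _ x ⟨β.2, γ.2⟩, T'.trans_eq _ _ x ⟨β.2, γ.2⟩,
        dfun_eq_add_sub ((U β.1).isOpen.inter (U γ.1).isOpen) (T.pot_smooth _ _)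
          ((hf _).mono inter_subset_left) ((hf _).mono inter_subset_right) (hp β.1 γ.1)
          ⟨β.2, γ.2⟩, add_assoc]
    -- A single pair of corresponding points over `x` suffices. By `ht` the shifted coordinates
    -- satisfy the transition rule of the second space.
    let r := T.space.point α hx 0
    let r' : T'.space.Fiber x := ⟨fun β => r.coord β - dfun 𝕜 E (f β.1) x, fun β γ => by
      rw [ht, r.compat β γ]
      abel⟩
    refine ContinuousLinearMap.ext fun a => ?_
    have h1 := congrArg (fun T : Dual 𝕜 A x => T a) (h x r r' fun _ => rfl)
    have h2 := (hc'.moment_apply hx r' a).symm.trans (h1.trans (hc.moment_apply hx r a))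
    change r.coord ⟨α, hx⟩ (L.anchor x a) - dfun 𝕜 E (f α) x (L.anchor x a) + c' α x a = _ at h2
    change c' α x a - c α x a = dfun 𝕜 E (f α) x (L.anchor x a)
    linear_combination h2
  · obtain ⟨α, hx⟩ := R.exists_index x
    refine ContinuousLinearMap.ext fun a => ?_
    have h1 := congrArg (fun T : Dual 𝕜 A x => T a) (h α x hx)
    change c' α x a - c α x a = dfun 𝕜 E (f α) x (L.anchor x a) at h1
    refine (hc'.moment_apply hx r' a).trans (Eq.trans ?_ (hc.moment_apply hx r a).symm)
    rw [hr]
    change r.coord ⟨α, hx⟩ (L.anchor x a) - dfun 𝕜 E (f α) x (L.anchor x a) + c' α x a = _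
    linear_combination h1

theorem HasForm.moment_eq_add {R R' : AffineSpace 𝕜 E U} {μ : Moment R A} {μ' : Moment R' A}
    {L : LieAlgebroid 𝕜 E F A} {c c' : ι → Π x : M, Dual 𝕜 A x} (h : HasForm L μ c)
    (h' : HasForm L μ' c') {α : ι} {x : M} (hx : x ∈ U α) (ξ : Cot 𝕜 E x) :
    μ' x (R'.point α hx ξ) = μ x (R.point α hx ξ) + (c' α x - c α x) := by
  refine ContinuousLinearMap.ext fun a => (h' α x hx ξ a).trans ?_
  change _ = μ x (R.point α hx ξ) a + (c' α x a - c α x a)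
  rw [h α x hx ξ a]
  ring

/-- The lifts to the affine spaces with transition forms `ς_αβ + dc_αβ` are classified by
`H¹(A, 𝒪(M))`. -/
theorem exists_classification_twistedLift [CompleteSpace E] [ContMDiffVectorBundle ∞ F A 𝓘(𝕜, E)]
    {L : LieAlgebroid 𝕜 E F A} {R : AffineSpace 𝕜 E U} {μ₀ : Moment R A}
    (hμ₀ : IsHamiltonianLift L μ₀) :
    ∃ Φ : TwistedLift R L → L.H1 U,
      Function.Surjective Φ ∧
      (∀ T T', Φ T = Φ T' ↔ T.Equivalent T') ∧
      ∀ T, ∃ (z : Cochain 𝕜 A ι) (hz : L.IsCocycle U z),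
        z.2 = T.pot ∧
        (∀ (α : ι) (x : M) (hx : x ∈ U α) (ξ : Cot 𝕜 E x),
          T.moment x (T.space.point α hx ξ) = μ₀ x (R.point α hx ξ) + z.1 α x) ∧
        Φ T = L.cls U z hz := by
  have h0 := hμ₀.hasForm
  set c₀ : ι → Π x : M, Dual 𝕜 A x := fun α x => Moment.loc μ₀ α ⟨x, 0⟩
  obtain ⟨hs, hcl, hg⟩ := hμ₀.form_spec h0
  have hz : ∀ T : TwistedLift R L, L.IsCocycle U
      (fun α x => Moment.loc T.moment α ⟨x, 0⟩ - c₀ α x, T.pot) := fun T =>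
    isCocycle_sub hμ₀ T.isLift h0 T.isLift.hasForm T.pot_smooth T.pot_cocycle T.trans_eq
  refine ⟨fun T => L.cls U _ (hz T), fun k => ?_, fun T T' => ?_,
    fun T => ⟨_, hz T, rfl, fun α x hx ξ => h0.moment_eq_add T.isLift.hasForm hx ξ, rfl⟩⟩
  · obtain ⟨⟨z, hz'⟩, rfl⟩ := QuotientAddGroup.mk_surjective k
    have hz' : L.IsCocycle U z := hz'
    let S := R.twist z.2 hz'.smooth_two hz'.cech
    have hform : HasForm L (Moment.ofForm S L fun α x => c₀ α x + z.1 α x)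
        fun α x => c₀ α x + z.1 α x :=
      Moment.ofForm_hasForm _ _ _ fun α β x hx => by
        have h1 := hg α β x hx
        have h2 := hz'.mixed α β x hx
        have h3 : (S.trans α β x).comp (L.anchor x)
            = (R.trans α β x).comp (L.anchor x) + L.d0 (z.2 α β) x := rfl
        rw [h3, ← h1, h2]
        abel
    let T : TwistedLift R L :=
      { pot := z.2
        pot_smooth := hz'.smooth_two
        pot_cocycle := hz'.cech
        space := S
        trans_eq := fun _ _ _ _ => rfl
        moment := Moment.ofForm S L fun α x => c₀ α x + z.1 α x
        isLift := hform.isHamiltonianLift (fun α => (hs α).add (hz'.smooth_one α))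
          fun α => (hcl α).add (hz'.closed α) (hs α) (hz'.smooth_one α) }
    -- The one-cochains of `T` and `z` agree over the `U α` but may differ outside, where
    -- `Moment.loc` is continued by zero. So only the classes are compared, with `f = 0`.
    refine ⟨T, (L.cls_eq_cls_iff (hz T) hz').2 ⟨fun _ _ => 0, fun α => contMDiffOn_const,
      fun α x hx => ?_, fun α β x _ => ?_⟩⟩
    · have h1 : Moment.loc T.moment α ⟨x, 0⟩ = c₀ α x + z.1 α x := (hform.eq_loc_zero hx).symm
      rw [LieAlgebroid.d0, dfun_zero]
      change z.1 α x - (Moment.loc T.moment α ⟨x, 0⟩ - c₀ α x) = 0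
      rw [h1]
      abel
    · change z.2 α β x = z.2 α β x + (0 - 0)
      rw [sub_zero, add_zero]
  · rw [L.cls_eq_cls_iff (hz T) (hz T'), T.equivalent_iff T.isLift.hasForm T'.isLift.hasForm]
    refine exists_congr fun f => and_congr_right fun _ => and_congr_left fun _ => ?_
    refine forall₃_congr fun α x _ => ?_
    change (_ - c₀ α x) - (_ - c₀ α x) = _ ↔ _
    rw [sub_sub_sub_cancel_right]

end TwistedLifts

/-! ### Classification of lifts to a fixed affine space -/

section Shifts

variable {𝕜 : Type*} [RCLike 𝕜] {E : Type*} [NormedAddCommGroup E] [NormedSpace 𝕜 E]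
  {M : Type*} [TopologicalSpace M] [ChartedSpace E M] [IsManifold 𝓘(𝕜, E) ∞ M]
  {F : Type*} [NormedAddCommGroup F] [NormedSpace 𝕜 F]
  {A : M → Type*} [∀ x, AddCommGroup (A x)] [∀ x, Module 𝕜 (A x)] [∀ x, TopologicalSpace (A x)]
  [TopologicalSpace (TotalSpace F A)] [FiberBundle F A] [VectorBundle 𝕜 F A]
  {ι : Type*} {U : ι → Opens M}

theorem DualOn.of_isOpenCover (hU : IsOpenCover U) {c : Π x : M, Dual 𝕜 A x}
    (h : ∀ α, DualOn 𝕜 E F c (U α)) (O : Set M) : DualOn 𝕜 E F c O := by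
  intro x _
  obtain ⟨α, hα⟩ := IsOpenCover.exists_mem hU x
  exact ((h α x hα).contMDiffAt ((U α).isOpen.mem_nhds hα)).contMDiffWithinAt

theorem LieAlgebroid.CocycleOn.of_isOpenCover (hU : IsOpenCover U) {L : LieAlgebroid 𝕜 E F A}
    {c : Π x : M, Dual 𝕜 A x} (h : ∀ α, L.CocycleOn c (U α)) (O : Set M) : L.CocycleOn c O := by
  intro W hW _ σ τ hσ hτ x hx
  obtain ⟨α, hα⟩ := IsOpenCover.exists_mem hU x
  exact h α _ (hW.inter (U α).isOpen) inter_subset_right σ τ (hσ.mono inter_subset_left)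
    (hτ.mono inter_subset_left) x ⟨hx, hα⟩

theorem LieAlgebroid.isCocycle_global {L : LieAlgebroid 𝕜 E F A} {c : Π x : M, Dual 𝕜 A x}
    (h : ∀ O, DualOn 𝕜 E F c O) (h' : ∀ O, L.CocycleOn c O) :
    L.IsCocycle (fun _ : Unit => (⊤ : Opens M)) (fun _ => c, fun _ _ _ => 0) := by
  refine ⟨fun _ => h _, fun _ _ => contMDiffOn_const, fun _ => h' _, fun _ _ x _ => ?_,
    fun _ _ _ x _ => (add_zero 0).symm⟩
  rw [LieAlgebroid.d0, dfun_zero]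
  exact (neg_add_cancel (c x)).symm

/-- The left side does not involve `α` and the right side does not involve `r`. So the difference of
two lifts is a section of `A*` defined on all of `M`. -/
theorem HasForm.sub_eq {R : AffineSpace 𝕜 E U} {μ μ' : Moment R A} {L : LieAlgebroid 𝕜 E F A}
    {c c' : ι → Π x : M, Dual 𝕜 A x} (h : HasForm L μ c) (h' : HasForm L μ' c') {α : ι} {x : M}
    (hx : x ∈ U α) (r : R.Fiber x) : μ' x r - μ x r = c' α x - c α x := by
  refine ContinuousLinearMap.ext fun a => ?_
  change μ' x r a - μ x r a = c' α x a - c α x a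
  rw [h.moment_apply hx, h'.moment_apply hx, add_sub_add_left_eq_sub]

theorem HasForm.moment_vadd {R : AffineSpace 𝕜 E U} {μ : Moment R A} {L : LieAlgebroid 𝕜 E F A}
    {c : ι → Π x : M, Dual 𝕜 A x} (h : HasForm L μ c) {x : M} (p : Cot 𝕜 E x) (r : R.Fiber x) :
    μ x (p +ᵥ r) = p.comp (L.anchor x) + μ x r := by
  obtain ⟨α, hx⟩ := R.exists_index x
  refine ContinuousLinearMap.ext fun a => (h.moment_apply hx _ a).trans ?_
  change p (L.anchor x a) + r.coord ⟨α, hx⟩ (L.anchor x a) + c α x a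
    = p (L.anchor x a) + μ x r a
  rw [h.moment_apply hx, add_assoc]

/-- Two lifts to the same affine space differ by a global one-cocycle. -/
theorem IsHamiltonianLift.exists_eq_add [CompleteSpace E] [ContMDiffVectorBundle ∞ F A 𝓘(𝕜, E)]
    {R : AffineSpace 𝕜 E U} {μ μ' : Moment R A} {L : LieAlgebroid 𝕜 E F A}
    (h : IsHamiltonianLift L μ) (h' : IsHamiltonianLift L μ') :
    ∃ c : Π x : M, Dual 𝕜 A x,
      L.IsCocycle (fun _ : Unit => (⊤ : Opens M)) (fun _ => c, fun _ _ _ => 0) ∧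
      ∀ (x : M) (r : R.Fiber x), μ' x r = μ x r + c x := by
  have hf := h.hasForm
  have hf' := h'.hasForm
  obtain ⟨hs, hcl, -⟩ := h.form_spec hf
  obtain ⟨hs', hcl', -⟩ := h'.form_spec hf'
  -- Any point of each fibre would do, because the difference of the lifts is constant along fibres.
  let r₀ := fun x => R.point (R.exists_index x).some.1 (R.exists_index x).some.2 0
  refine ⟨fun x => μ' x (r₀ x) - μ x (r₀ x), LieAlgebroid.isCocycle_global ?_ ?_, fun x r => ?_⟩
  · exact DualOn.of_isOpenCover R.cover fun α =>
      ((hs' α).sub (hs α)).congr fun x hx => hf.sub_eq hf' hx (r₀ x)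
  · exact LieAlgebroid.CocycleOn.of_isOpenCover R.cover fun α =>
      ((hcl' α).sub (hcl α) (hs' α) (hs α)).congr fun x hx => hf.sub_eq hf' hx (r₀ x)
  · obtain ⟨α, hx⟩ := R.exists_index x
    change _ = μ x r + (μ' x (r₀ x) - μ x (r₀ x))
    rw [hf.sub_eq hf' hx (r₀ x), ← hf.sub_eq hf' hx r, add_sub_cancel]

theorem IsHamiltonianLift.add_cocycle [CompleteSpace E] [ContMDiffVectorBundle ∞ F A 𝓘(𝕜, E)]
    {R : AffineSpace 𝕜 E U} {μ : Moment R A} {L : LieAlgebroid 𝕜 E F A}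
    (h : IsHamiltonianLift L μ) {c : Π x : M, Dual 𝕜 A x} (hc : DualOn 𝕜 E F c univ)
    (hcl : L.CocycleOn c univ) : IsHamiltonianLift L (fun x r => μ x r + c x : Moment R A) := by
  obtain ⟨hs, hcl₀, -⟩ := h.form_spec h.hasForm
  have hf : HasForm L (fun x r => μ x r + c x : Moment R A)
      fun α x => Moment.loc μ α ⟨x, 0⟩ + c x := fun α x hx ξ a => by
    change μ x (R.point α hx ξ) a + c x a = ξ (L.anchor x a)
      + (Moment.loc μ α ⟨x, 0⟩ a + c x a)
    rw [h.hasForm α x hx ξ a, add_assoc]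
  have hc' : ∀ α, DualOn 𝕜 E F c (U α) := fun α => ContMDiffOn.mono hc (subset_univ _)
  exact hf.isHamiltonianLift (fun α => (hs α).add (hc' α)) fun α => (hcl₀ α).add
    (fun W hW _ => hcl W hW (subset_univ _)) (hs α) (hc' α)

/-- The lifts to a fixed affine space are classified by the global one-cocycles of the algebroid
modulo the coboundaries of global functions. -/
theorem exists_classification_lift [CompleteSpace E] [ContMDiffVectorBundle ∞ F A 𝓘(𝕜, E)]
    {L : LieAlgebroid 𝕜 E F A} {R : AffineSpace 𝕜 E U} {μ₀ : Moment R A}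
    (hμ₀ : IsHamiltonianLift L μ₀) :
    ∃ Φ : {μ : Moment R A // IsHamiltonianLift L μ} → L.H1 (fun _ : Unit => (⊤ : Opens M)),
      Function.Surjective Φ ∧
      (∀ μ μ', Φ μ = Φ μ' ↔ ShiftEquivalent μ.1 μ'.1) ∧
      ∀ μ, ∃ (c : Π x : M, Dual 𝕜 A x)
        (hz : L.IsCocycle (fun _ : Unit => (⊤ : Opens M)) (fun _ => c, fun _ _ _ => 0)),
        (∀ (x : M) (r : R.Fiber x), μ.1 x r = μ₀ x r + c x) ∧
        Φ μ = L.cls (fun _ : Unit => (⊤ : Opens M)) (fun _ => c, fun _ _ _ => 0) hz := by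
  choose c hz hc using fun μ : {μ : Moment R A // IsHamiltonianLift L μ} =>
    hμ₀.exists_eq_add μ.2
  refine ⟨fun μ => L.cls _ _ (hz μ), fun k => ?_, fun μ μ' => ?_,
    fun μ => ⟨c μ, hz μ, hc μ, rfl⟩⟩
  · obtain ⟨⟨z, hz'⟩, rfl⟩ := QuotientAddGroup.mk_surjective k
    have hz' : L.IsCocycle (fun _ : Unit => (⊤ : Opens M)) z := hz'
    let μ : {μ : Moment R A // IsHamiltonianLift L μ} :=
      ⟨fun x r => μ₀ x r + z.1 () x, hμ₀.add_cocycle (hz'.smooth_one ()) (hz'.closed ())⟩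
    refine ⟨μ, (L.cls_eq_cls_iff (hz μ) hz').2 ⟨fun _ _ => 0, fun _ => contMDiffOn_const,
      fun _ x _ => ?_, fun _ _ x _ => ?_⟩⟩
    · obtain ⟨α, hx⟩ := R.exists_index x
      rw [LieAlgebroid.d0, dfun_zero]
      exact sub_eq_zero.2 (add_left_cancel (hc μ x (R.point α hx 0)))
    · have h := hz'.cech () () () x ⟨⟨trivial, trivial⟩, trivial⟩
      change z.2 () () x = 0 + (0 - 0)
      linear_combination -h
  · rw [L.cls_eq_cls_iff (hz μ) (hz μ')]
    -- The shift by `-df` changes the second lift by `-δf` at all points of the fibre alike, so one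
    -- point decides.
    have key : ∀ (f : M → 𝕜) (x : M), (∀ r : R.Fiber x,
        μ'.1 x (-dfun 𝕜 E f x +ᵥ r) = μ.1 x r) ↔ c μ' x - c μ x = L.d0 f x := fun f x => by
      have e : ∀ r : R.Fiber x, μ'.1 x (-dfun 𝕜 E f x +ᵥ r) = μ.1 x r
          ↔ c μ' x - c μ x = L.d0 f x := fun r => by
        rw [μ'.2.hasForm.moment_vadd, hc μ, hc μ']
        change -L.d0 f x + _ = _ ↔ _
        rw [neg_add_eq_iff_eq_add, add_left_comm, add_right_inj, sub_eq_iff_eq_add]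
      obtain ⟨α, hx⟩ := R.exists_index x
      exact ⟨fun h => (e _).1 (h (R.point α hx 0)), fun h r => (e r).2 h⟩
    constructor
    · rintro ⟨f, hf, h, -⟩
      exact ⟨f (), hf (), fun x => (key _ x).2 (h () x trivial)⟩
    · rintro ⟨f, hf, h⟩
      exact ⟨fun _ => f, fun _ => hf, fun _ x _ => (key f x).1 (h x), fun _ _ x _ => by simp⟩

end Shifts

end Algd

end

theorem lemma2p1 {𝕜 : Type*} [RCLike 𝕜]
    {E : Type*} [NormedAddCommGroup E] [NormedSpace 𝕜 E] [FiniteDimensional 𝕜 E]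
    {M : Type*} [TopologicalSpace M] [ChartedSpace E M] [IsManifold 𝓘(𝕜, E) ∞ M]
    {F : Type*} [NormedAddCommGroup F] [NormedSpace 𝕜 F] [FiniteDimensional 𝕜 F]
    {A : M → Type*} [∀ x, AddCommGroup (A x)] [∀ x, Module 𝕜 (A x)]
    [∀ x, TopologicalSpace (A x)] [TopologicalSpace (TotalSpace F A)] [FiberBundle F A]
    [VectorBundle 𝕜 F A] [ContMDiffVectorBundle ∞ F A 𝓘(𝕜, E)]
    (L : Algd.LieAlgebroid 𝕜 E F A)
    {ι : Type*} (U : ι → Opens M) (hU : IsOpenCover U) :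
    -- all Hamiltonian lifts to an affine space `R`, and how they are glued
    (∀ (R : Algd.AffineSpace 𝕜 E U) (μ : Algd.Moment R A),
      Algd.IsHamiltonianLift L μ ↔
        ∃ c : ι → Π x : M, Algd.Dual 𝕜 A x,
          (∀ α, Algd.DualOn 𝕜 E F (c α) (U α)) ∧
          (∀ α, L.CocycleOn (c α) (U α)) ∧
          (∀ α β, ∀ x ∈ (U α ∩ U β : Set M),
            c β x - c α x = (R.trans α β x).comp (L.anchor x)) ∧
          Algd.HasForm L μ c) ∧
    -- the action on sections of `R`: `ρ_ε ξ_α = ℒ_{δ_ε} ξ_α + d(c_α(ε))`, the same for all `α`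
    (∀ (R : Algd.AffineSpace 𝕜 E U) (μ : Algd.Moment R A) (c : ι → Π x : M, Algd.Dual 𝕜 A x),
      Algd.IsHamiltonianLift L μ → Algd.HasForm L μ c →
      ∀ (W : Set M) (ε : Π x : M, A x) (s : Π x : M, R.Fiber x), IsOpen W →
        Algd.SecOn 𝕜 E F ε W → R.SectionOn s W → ∀ x ∈ W,
          ∃ ρ : Algd.Cot 𝕜 E x, ∀ α, x ∈ U α →
            (∀ (O : Set M) (Y : Π x : M, TangentSpace 𝓘(𝕜, E) x), IsOpen O → x ∈ O →
              Algd.FieldOn 𝕜 E Y O →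
                ρ (Y x) = L.act ε (fun y => R.localForm s α y (Y y)) x
                  - R.localForm s α x
                      (mlieBracket 𝓘(𝕜, E) (fun y => L.anchor y (ε y)) Y x)
                  + Algd.along 𝕜 E (fun y => c α y (ε y)) x (Y x)) ∧
            Algd.IsHamAt 𝕜 (Algd.Moment.ham μ ε α) ⟨x, R.localForm s α x⟩
              (mfderiv 𝓘(𝕜, E) (Algd.cotModel 𝕜 E)
                  (fun y => (⟨y, R.localForm s α y⟩ : Algd.CotBundle 𝕜 E M)) x
                  (L.anchor x (ε x))
                - Algd.ofComps 𝕜 ⟨x, R.localForm s α x⟩ 0 ρ)) ∧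
    -- every one-cocycle of the algebroid gives a lift
    (∀ z : Algd.Cochain 𝕜 A ι, L.IsCocycle U z →
      ∃ (R : Algd.AffineSpace 𝕜 E U) (μ : Algd.Moment R A),
        (∀ α β, ∀ x ∈ (U α ∩ U β : Set M), R.trans α β x = Algd.dfun 𝕜 E (z.2 α β) x) ∧
        Algd.IsHamiltonianLift L μ ∧ Algd.HasForm L μ z.1) ∧
    -- classification of the lifts to the affine spaces with transition forms `ς_αβ + dc_αβ`
    (∀ (R : Algd.AffineSpace 𝕜 E U) (μ₀ : Algd.Moment R A), Algd.IsHamiltonianLift L μ₀ →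
      ∃ Φ : Algd.TwistedLift R L → L.H1 U,
        Function.Surjective Φ ∧
        (∀ T T', Φ T = Φ T' ↔ T.Equivalent T') ∧
        ∀ T, ∃ (z : Algd.Cochain 𝕜 A ι) (hz : L.IsCocycle U z),
          z.2 = T.pot ∧
          (∀ (α : ι) (x : M) (hx : x ∈ U α) (ξ : Algd.Cot 𝕜 E x),
            T.moment x (T.space.point α hx ξ) = μ₀ x (R.point α hx ξ) + z.1 α x) ∧
          Φ T = L.cls U z hz) ∧
    -- classification of the lifts to a fixed affine space
    (∀ (R : Algd.AffineSpace 𝕜 E U) (μ₀ : Algd.Moment R A), Algd.IsHamiltonianLift L μ₀ →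
      ∃ Φ : {μ : Algd.Moment R A // Algd.IsHamiltonianLift L μ} →
          L.H1 (fun _ : Unit => (⊤ : Opens M)),
        Function.Surjective Φ ∧
        (∀ μ μ', Φ μ = Φ μ' ↔ Algd.ShiftEquivalent μ.1 μ'.1) ∧
        ∀ μ, ∃ (c : Π x : M, Algd.Dual 𝕜 A x)
          (hz : L.IsCocycle (fun _ : Unit => (⊤ : Opens M)) (fun _ => c, fun _ _ _ => 0)),
          (∀ (x : M) (r : R.Fiber x), μ.1 x r = μ₀ x r + c x) ∧
          Φ μ = L.cls (fun _ : Unit => (⊤ : Opens M)) (fun _ => c, fun _ _ _ => 0) hz) := by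
  have : CompleteSpace E := FiniteDimensional.complete 𝕜 E
  exact ⟨fun _ _ => Algd.isHamiltonianLift_iff,
    fun _ _ _ h hc _ _ _ hW hε hs _ hx => h.exists_action_on_section hc hW hε hs hx,
    fun _ hz => hz.exists_lift hU,
    fun _ _ h => Algd.exists_classification_twistedLift h,
    fun _ _ h => Algd.exists_classification_lift h⟩
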